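/- Let $\mathcal I$ be a direct category: a skeletal small category admitting a functor to an ordinal $\zeta$ (viewed as a category) that sends non-identity morphisms to non-identity morphisms. Let $\mathscr R$ be a representation of $\mathcal I$ on rings, i.e. a (pseudo)functor assigning to each object $i$ an associative unital ring $R_i$ and to each morphism $\alpha\colon i\to j$ a ring homomorphism $R_i\to R_j$ (rings being viewed as one-object preadditive categories). Let $\overline{\mathscr R}\text{-}\mathsf{Rep}$ be the category of left $\mathscr R$-modules: an object $M$ consists of left $R_i$-modules $M_i$ and $R_j$-linear maps $M_\alpha\colon R_j\otimes_{R_i}M_i\to M_j$ for $\alpha\colon i\to j$, compatible with identities and composition. Let $\widetilde{\mathscr R}\text{-}\mathsf{Rep}$ be the category of right $\mathscr R$-modules: an object $N$ consists of right $R_i$-modules $N_i$ and $R_i$-linear maps $N_\alpha\colon N_j\to N_i$ for $\alpha\colon i\to j$ (where $R_i$ acts on $N_j$ through $R_i\to R_j$), compatible with identities and composition. In both categories exactness is componentwise. For $M\in\overline{\mathscr R}\text{-}\mathsf{Rep}$ let $\mathrm{Hom}(M,-)\colon \mathbb Z\text{-}\mathsf{Mod}\to\widetilde{\mathscr R}\text{-}\mathsf{Rep}$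 be the functor with $\mathrm{Hom}(M,G)_i=\mathrm{Hom}_{\mathbb Z}(M_i,G)$ and structure maps induced by those of $M$, and let $M\otimes_R-\colon\widetilde{\mathscr R}\text{-}\mathsf{Rep}\to\mathbb Z\text{-}\mathsf{Mod}$ be its left adjoint. The object $M$ is called (categorically) flat if $M\otimes_R-$ is exact. For each $i$ let $$\varphi_i^M\colon \operatorname*{colim}_{\alpha\colon h\to i,\ h\neq i} R_i\otimes_{R_h}M_h\longrightarrow M_i$$ be the canonical (latching) morphism of left $R_i$-modules induced by the maps $M_\alpha$; the colimit is over the category of morphisms $\alpha\colon h\to i$ with $h\ne i$, whose morphisms $\alpha\to\alpha'$ are the $\gamma\colon h\to h'$ with $\alpha'\gamma=\alpha$. Then an object $M$ of $\overline{\mathscr R}\text{-}\mathsf{Rep}$ is flat if and only if, for every object $i$ of $\mathcal I$, $\varphi_i^M$ is a monomorphism and $\operatorname{coker}(\varphi_i^M)$ is a flat left $R_i$-module. That is, the subcategory of flat objects of $\overline{\mathscr R}\text{-}\mathsf{Rep}$ equals $\Phi(\mathsf{Flat}_\bullet)$. -/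

import Mathlib

open CategoryTheory CategoryTheory.Limits MulOpposite
open scoped TensorProduct DirectSum

universe u

namespace DiagRep

noncomputable section

/-! ### Direct categories -/

/-- A (small) category is direct if it is skeletal and admits a functor to an ordinal (viewed as a
category) which sends non-identity morphisms to non-identity morphisms.  In a poset, the morphism
`F.map f` is an identity exactly when its source and target agree. -/
def IsDirectCategory (I : Type u) [SmallCategory I] : Prop :=
  Skeletal I ∧ ∃ (ζ : Ordinal.{u}) (F : I ⥤ ζ.ToType), ∀ ⦃i j : I⦄ (f : i ⟶ j),
    F.obj i = F.obj j → ∃ h : i = j, f = eqToHom h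

/-! ### Representations of a category on rings -/

/-- A representation of `I` on the category of (associative, unital) rings: an `I`-diagram
of rings, where a ring is viewed as a preadditive category with one object. Thus it is a
pseudofunctor: the natural isomorphisms `𝟭 ≅ ℛ_{𝟙 i}` and `ℛ_β ∘ ℛ_α ≅ ℛ_{βα}` between functors of
one-object categories are given by units `eta` and `tau`, subject to naturality and coherence.
Strict functors are the case `eta = 1`, `tau = 1`, see `RingDiagram.ofFunctor`. -/
structure RingDiagram (I : Type u) [SmallCategory I] where
  obj : I → Type u
  [ring : ∀ i, Ring (obj i)]
  map : ∀ {i j : I}, (i ⟶ j) → (obj i →+* obj j)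
  eta : ∀ i : I, (obj i)ˣ
  tau : ∀ {i j k : I}, (i ⟶ j) → (j ⟶ k) → (obj k)ˣ
  eta_naturality : ∀ (i : I) (x : obj i), (eta i : obj i) * x = map (𝟙 i) x * eta i
  tau_naturality : ∀ {i j k : I} (α : i ⟶ j) (β : j ⟶ k) (x : obj i),
    (tau α β : obj k) * map β (map α x) = map (α ≫ β) x * tau α β
  assoc : ∀ {i j k l : I} (α : i ⟶ j) (β : j ⟶ k) (γ : k ⟶ l),
    (tau (α ≫ β) γ : obj l) * map γ (tau α β) = tau α (β ≫ γ) * tau β γ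
  id_left : ∀ {i j : I} (α : i ⟶ j), (tau (𝟙 i) α : obj j) * map α (eta i) = 1
  id_right : ∀ {i j : I} (α : i ⟶ j), (tau α (𝟙 j) : obj j) * eta j = 1

attribute [instance] RingDiagram.ring

/-- An ordinary functor to the category of rings is a representation on rings. -/
def RingDiagram.ofFunctor {I : Type u} [SmallCategory I] (F : I ⥤ RingCat.{u}) :
    RingDiagram I where
  obj i := F.obj i
  map α := (F.map α).hom
  eta _ := 1
  tau _ _ := 1
  eta_naturality := by simp
  tau_naturality := by simp
  assoc := by simp
  id_left := by simp
  id_right := by simp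

/-! ### Extension of scalars over noncommutative rings -/

section BaseChange

variable {A B : Type u} [Ring A] [Ring B] (f : A →+* B)

/-- The left `B`-module `B ⊗_A M`, for a ring homomorphism `f : A → B` and a left `A`-module `M`:
the quotient of `B ⊗_ℤ M` by the relations `b f(a) ⊗ m = b ⊗ a m`. -/
def BaseChange (M : Type u) [AddCommGroup M] [Module A M] : Type u :=
  (B ⊗[ℤ] M) ⧸ Submodule.span B
    {x : B ⊗[ℤ] M | ∃ (b : B) (a : A) (m : M), x = (b * f a) ⊗ₜ[ℤ] m - b ⊗ₜ[ℤ] (a • m)}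

namespace BaseChange

variable (M : Type u) [AddCommGroup M] [Module A M]

instance : AddCommGroup (BaseChange f M) :=
  inferInstanceAs (AddCommGroup ((B ⊗[ℤ] M) ⧸ Submodule.span B _))

instance : Module B (BaseChange f M) :=
  inferInstanceAs (Module B ((B ⊗[ℤ] M) ⧸ Submodule.span B _))

variable {M}

/-- The pure tensor `b ⊗ m` in `B ⊗_A M`. -/
def tmul (b : B) (m : M) : BaseChange f M :=
  Submodule.Quotient.mk (b ⊗ₜ[ℤ] m)

theorem tmul_add (b : B) (m m' : M) : tmul f b (m + m') = tmul f b m + tmul f b m' := by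
  unfold tmul; rw [TensorProduct.tmul_add]; rfl

theorem smul_tmul (c b : B) (m : M) : c • tmul f b m = tmul f (c * b) m := rfl

theorem tmul_smul (b : B) (a : A) (m : M) : tmul f b (a • m) = tmul f (b * f a) m :=
  Eq.symm <| (Submodule.Quotient.eq (Submodule.span B
    {x : B ⊗[ℤ] M | ∃ (b : B) (a : A) (m : M),
      x = (b * f a) ⊗ₜ[ℤ] m - b ⊗ₜ[ℤ] (a • m)})).2 (Submodule.subset_span ⟨b, a, m, rfl⟩)

theorem induction_on {p : BaseChange f M → Prop} (x : BaseChange f M) (zero : p 0)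
    (tmul : ∀ b m, p (tmul f b m)) (add : ∀ x y, p x → p y → p (x + y)) : p x := by
  obtain ⟨x, rfl⟩ := Submodule.Quotient.mk_surjective _ x
  induction x using TensorProduct.induction_on with
  | zero => exact zero
  | tmul b m => exact tmul b m
  | add x y hx hy => exact add _ _ hx hy

variable {N : Type u} [AddCommGroup N] [Module B N]

theorem hom_ext {g h : BaseChange f M →ₗ[B] N} (H : ∀ m, g (tmul f 1 m) = h (tmul f 1 m)) :
    g = h := by
  ext x
  induction x using induction_on with
  | zero => simp
  | tmul b m =>
    have : tmul f b m = b • tmul f 1 m := by rw [smul_tmul, mul_one]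
    rw [this, map_smul, map_smul, H]
  | add x y hx hy => rw [map_add, map_add, hx, hy]

/-- The `B`-linear map `B ⊗_A M → N`, `b ⊗ m ↦ b • g m`, induced by an `f`-semilinear map `g`. -/
def lift (g : M →ₛₗ[f] N) : BaseChange f M →ₗ[B] N :=
  Submodule.liftQ _
    (TensorProduct.AlgebraTensorModule.lift
      (LinearMap.toSpanSingleton B (M →ₗ[ℤ] N) g.toAddMonoidHom.toIntLinearMap)) <| by
    rw [Submodule.span_le]
    rintro _ ⟨b, a, m, rfl⟩
    simp [mul_smul]

@[simp]
theorem lift_tmul (g : M →ₛₗ[f] N) (b : B) (m : M) : lift f g (tmul f b m) = b • g m := rfl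

/-- The universal property of `B ⊗_A M`: a `B`-linear map `B ⊗_A M → N` is the same as an
`A`-linear map from `M` to the restriction of `N`, that is, an `f`-semilinear map `M → N`. -/
def liftEquiv : (M →ₛₗ[f] N) ≃ (BaseChange f M →ₗ[B] N) where
  toFun := lift f
  invFun h :=
    { toFun := fun m => h (tmul f 1 m)
      map_add' := fun m m' => by rw [tmul_add, map_add]
      map_smul' := fun a m => by
        rw [tmul_smul, one_mul, ← map_smul, smul_tmul, mul_one] }
  left_inv g := by ext m; simp
  right_inv h := hom_ext f fun m => by simp

end BaseChange

end BaseChange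

/-! ### The tensor product of a right and a left module over a noncommutative ring -/

section RingTensor

variable (A : Type u) [Ring A]

/-- The abelian group `N ⊗_A M` for a right `A`-module `N` and a left `A`-module `M`:
the quotient of `N ⊗_ℤ M` by the relations `n a ⊗ m = n ⊗ a m`. -/
def RingTensor (N M : Type u) [AddCommGroup N] [Module Aᵐᵒᵖ N] [AddCommGroup M] [Module A M] :
    Type u :=
  (N ⊗[ℤ] M) ⧸ AddSubgroup.closure
    {x : N ⊗[ℤ] M | ∃ (n : N) (a : A) (m : M), x = (op a • n) ⊗ₜ[ℤ] m - n ⊗ₜ[ℤ] (a • m)}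

namespace RingTensor

variable (N M : Type u) [AddCommGroup N] [Module Aᵐᵒᵖ N] [AddCommGroup M] [Module A M]

instance : AddCommGroup (RingTensor A N M) :=
  inferInstanceAs (AddCommGroup ((N ⊗[ℤ] M) ⧸ AddSubgroup.closure _))

variable {N M}

/-- The pure tensor `n ⊗ m` in `N ⊗_A M`. -/
def tmul (n : N) (m : M) : RingTensor A N M :=
  QuotientAddGroup.mk (n ⊗ₜ[ℤ] m)

theorem tmul_add (n : N) (m m' : M) : tmul A n (m + m') = tmul A n m + tmul A n m' := by
  unfold tmul; rw [TensorProduct.tmul_add]; rfl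

theorem add_tmul (n n' : N) (m : M) : tmul A (n + n') m = tmul A n m + tmul A n' m := by
  unfold tmul; rw [TensorProduct.add_tmul]; rfl

theorem smul_tmul (n : N) (a : A) (m : M) : tmul A (op a • n) m = tmul A n (a • m) :=
  (QuotientAddGroup.eq_iff_sub_mem).2 (AddSubgroup.subset_closure ⟨n, a, m, rfl⟩)

theorem induction_on {p : RingTensor A N M → Prop} (x : RingTensor A N M) (zero : p 0)
    (tmul : ∀ n m, p (tmul A n m)) (add : ∀ x y, p x → p y → p (x + y)) : p x := by
  obtain ⟨x, rfl⟩ := QuotientAddGroup.mk_surjective x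
  induction x using TensorProduct.induction_on with
  | zero => exact zero
  | tmul b m => exact tmul b m
  | add x y hx hy => exact add _ _ hx hy

/-- The additive map `N ⊗_A M → G` induced by a balanced biadditive map. -/
def lift {G : Type u} [AddCommGroup G] (g : N →+ M →+ G)
    (hg : ∀ n (a : A) m, g (op a • n) m = g n (a • m)) : RingTensor A N M →+ G :=
  QuotientAddGroup.lift _
    (TensorProduct.liftAddHom g fun r n m => by simp) <| by
    rw [AddSubgroup.closure_le]
    rintro _ ⟨n, a, m, rfl⟩
    simp [hg]

@[simp]
theorem lift_tmul {G : Type u} [AddCommGroup G] (g : N →+ M →+ G)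
    (hg : ∀ n (a : A) m, g (op a • n) m = g n (a • m)) (n : N) (m : M) :
    lift A g hg (tmul A n m) = g n m := rfl

/-- The biadditive map `(n, m) ↦ n ⊗ m`. -/
def mk : N →+ M →+ RingTensor A N M where
  toFun n :=
    { toFun := fun m => tmul A n m
      map_zero' := by unfold tmul; rw [TensorProduct.tmul_zero]; rfl
      map_add' := tmul_add A n }
  map_zero' := by ext m; change tmul A 0 m = 0; unfold tmul; rw [TensorProduct.zero_tmul]; rfl
  map_add' n n' := by ext m; exact add_tmul A n n' m

@[simp]
theorem mk_apply (n : N) (m : M) : mk A n m = tmul A n m := rfl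

/-- Functoriality of `N ⊗_A M` in the right module `N`. -/
def mapLeft {N' : Type u} [AddCommGroup N'] [Module Aᵐᵒᵖ N'] (M : Type u) [AddCommGroup M]
    [Module A M] (f : N →ₗ[Aᵐᵒᵖ] N') : RingTensor A N M →+ RingTensor A N' M :=
  lift A ((mk A).comp f.toAddMonoidHom) fun n a m => by
    simp [smul_tmul]

@[simp]
theorem mapLeft_tmul {N' : Type u} [AddCommGroup N'] [Module Aᵐᵒᵖ N'] (f : N →ₗ[Aᵐᵒᵖ] N')
    (n : N) (m : M) : mapLeft A M f (tmul A n m) = tmul A (f n) m := rfl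

end RingTensor

/-- The property that the additive maps `f`, `g` form a short exact sequence
`0 → X → Y → Z → 0`. -/
def IsShortExact {X Y Z : Type u} [AddCommGroup X] [AddCommGroup Y] [AddCommGroup Z]
    (f : X →+ Y) (g : Y →+ Z) : Prop :=
  Function.Injective f ∧ Function.Exact f g ∧ Function.Surjective g

/-- The flat left `A`-modules: those `M` for which `- ⊗_A M` is exact. -/
def flatModules : ObjectProperty (ModuleCat.{u} A) := fun M =>
  ∀ (N N' N'' : ModuleCat.{u} Aᵐᵒᵖ) (f : N ⟶ N') (g : N' ⟶ N''),
    IsShortExact f.hom.toAddMonoidHom g.hom.toAddMonoidHom →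
      IsShortExact (RingTensor.mapLeft A M f.hom) (RingTensor.mapLeft A M g.hom)

end RingTensor

variable {I : Type u} [SmallCategory I] (R : RingDiagram I)

/-! ### The category of left representations -/

/-- A representation over the diagram of left module categories `i ↦ R_i-Mod`,
`α ↦ R_j ⊗_{R_i} -`.  The structural morphism `R_j ⊗_{R_i} M_i → M_j` is given by the corresponding
semilinear map `M_i → M_j` (see `BaseChange.liftEquiv` and `LeftRep.str`). -/
structure LeftRep where
  obj : ∀ i : I, ModuleCat.{u} (R.obj i)
  map : ∀ {i j : I} (α : i ⟶ j), obj i →ₛₗ[R.map α] obj j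
  map_id : ∀ (i : I) (m : obj i), map (𝟙 i) m = (R.eta i : R.obj i) • m
  map_comp : ∀ {i j k : I} (α : i ⟶ j) (β : j ⟶ k) (m : obj i),
    map (α ≫ β) m = (R.tau α β : R.obj k) • map β (map α m)

namespace LeftRep

variable {R}

/-- The structural morphism `R_j ⊗_{R_i} M_i → M_j`. -/
def str (M : LeftRep R) {i j : I} (α : i ⟶ j) :
    BaseChange (R.map α) (M.obj i) →ₗ[R.obj j] M.obj j :=
  BaseChange.lift (R.map α) (M.map α)

/-- Morphisms of left representations. -/
@[ext]
structure Hom (M M' : LeftRep R) where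
  app : ∀ i : I, M.obj i →ₗ[R.obj i] M'.obj i
  naturality : ∀ {i j : I} (α : i ⟶ j) (m : M.obj i),
    app j (M.map α m) = M'.map α (app i m)

instance : Category (LeftRep R) where
  Hom := Hom
  id M := ⟨fun _ => LinearMap.id, fun _ _ => rfl⟩
  comp f g := ⟨fun i => (g.app i).comp (f.app i), fun α m => by
    simp [f.naturality, g.naturality]⟩

end LeftRep

/-! ### Latching objects and the subcategories `Φ(𝒳)` -/

/-- The category of morphisms `α : h ⟶ i` with `h ≠ i`, a morphism from `α : h ⟶ i` to
`α' : h' ⟶ i` being some `γ : h ⟶ h'` with `γ ≫ α' = α`. -/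
abbrev LatchingIndex (i : I) : Type u :=
  ObjectProperty.FullSubcategory (fun α : Over i => α.left ≠ i)

namespace LeftRep

variable {R}

/-- The diagram `(α : h ⟶ i) ↦ R_i ⊗_{R_h} M_h` indexed by the morphisms `α` to `i` with source
different from `i`.  A morphism `γ` from `α` to `α'` acts as the composite
`R_i ⊗_{R_h} M_h ≅ R_i ⊗_{R_{h'}} (R_{h'} ⊗_{R_h} M_h) → R_i ⊗_{R_{h'}} M_{h'}`, that is,
`b ⊗ m ↦ b τ ⊗ M_γ(m)`. -/
def latchingDiagram (M : LeftRep R) (i : I) : LatchingIndex i ⥤ ModuleCat.{u} (R.obj i) where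
  obj α := ModuleCat.of (R.obj i) (BaseChange (R.map α.obj.hom) (M.obj α.obj.left))
  map {α α'} γ := ModuleCat.ofHom <| BaseChange.lift (R.map α.obj.hom)
    { toFun := fun m => BaseChange.tmul (R.map α'.obj.hom)
        (R.tau γ.hom.left α'.obj.hom : R.obj i) (M.map γ.hom.left m)
      map_add' := fun m m' => by rw [map_add, BaseChange.tmul_add]
      map_smul' := fun a m => by
        rw [LinearMap.map_smulₛₗ, BaseChange.tmul_smul, R.tau_naturality, BaseChange.smul_tmul,
          Over.w] }
  map_id α := by
    ext1
    refine BaseChange.hom_ext _ fun m => ?_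
    change (1 : R.obj i) • BaseChange.tmul (R.map α.obj.hom)
      (R.tau (𝟙 α.obj.left) α.obj.hom : R.obj i) (M.map (𝟙 α.obj.left) m) =
        BaseChange.tmul (R.map α.obj.hom) 1 m
    rw [one_smul, M.map_id, BaseChange.tmul_smul, R.id_left]
  map_comp {α α' α''} γ δ := by
    ext1
    refine BaseChange.hom_ext _ fun m => ?_
    change (1 : R.obj i) • BaseChange.tmul (R.map α''.obj.hom)
      (R.tau (γ.hom.left ≫ δ.hom.left) α''.obj.hom : R.obj i)
        (M.map (γ.hom.left ≫ δ.hom.left) m) =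
      BaseChange.lift _ _ ((1 : R.obj i) • BaseChange.tmul (R.map α'.obj.hom)
        (R.tau γ.hom.left α'.obj.hom : R.obj i) (M.map γ.hom.left m))
    rw [one_smul, one_smul, M.map_comp, BaseChange.tmul_smul, R.assoc, BaseChange.lift_tmul]
    change _ = (R.tau γ.hom.left α'.obj.hom : R.obj i) • BaseChange.tmul (R.map α''.obj.hom)
      (R.tau δ.hom.left α''.obj.hom : R.obj i) (M.map δ.hom.left (M.map γ.hom.left m))
    rw [BaseChange.smul_tmul, Over.w]

/-- The latching object `L_i(M)`, the colimit of `R_i ⊗_{R_h} M_h` over all `α : h ⟶ i` with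
`h ≠ i`. -/
def latching (M : LeftRep R) (i : I) : ModuleCat.{u} (R.obj i) :=
  colimit (M.latchingDiagram i)

/-- The cocone over the latching diagram given by the structural morphisms
`R_i ⊗_{R_h} M_h → M_i`. -/
def latchingCocone (M : LeftRep R) (i : I) : Cocone (M.latchingDiagram i) where
  pt := M.obj i
  ι :=
    { app := fun α => ModuleCat.ofHom (M.str α.obj.hom)
      naturality := fun α α' γ => by
        ext1
        refine BaseChange.hom_ext _ fun m => ?_
        change M.str α'.obj.hom ((1 : R.obj i) • BaseChange.tmul (R.map α'.obj.hom)
            (R.tau γ.hom.left α'.obj.hom : R.obj i) (M.map γ.hom.left m)) =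
          (1 : R.obj i) • M.map α.obj.hom m
        rw [one_smul, one_smul, ← Over.w γ.hom, M.map_comp]
        rfl }

/-- The canonical morphism `φ_i^M : L_i(M) ⟶ M_i`. -/
def latchingMap (M : LeftRep R) (i : I) : M.latching i ⟶ M.obj i :=
  colimit.desc (M.latchingDiagram i) (M.latchingCocone i)

end LeftRep

/-- The subcategory `Φ(𝒳)` for a family `𝒳` of full subcategories of the categories `R_i-Mod`: all
representations `M` such that each `φ_i^M` is a monomorphism with cokernel in `𝒳_i`. -/
def Phi (X : ∀ i : I, ObjectProperty (ModuleCat.{u} (R.obj i))) : ObjectProperty (LeftRep R) :=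
  fun M => ∀ i : I, Mono (M.latchingMap i) ∧ X i (cokernel (M.latchingMap i))

/-! ### The category of right representations -/

/-- A representation over the `Iᵒᵖ`-diagram of right module categories `i ↦ Mod-R_i`, with
`α : i ⟶ j` acting by restriction of scalars `Mod-R_j → Mod-R_i`.  The structural morphism at
`α` is an `R_i`-linear map from the restriction of `N_j` to `N_i`. -/
structure RightRep where
  obj : ∀ i : I, ModuleCat.{u} (R.obj i)ᵐᵒᵖ
  map : ∀ {i j : I} (_ : i ⟶ j), obj j →+ obj i
  map_smul : ∀ {i j : I} (α : i ⟶ j) (a : R.obj i) (n : obj j),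
    map α (op (R.map α a) • n) = op a • map α n
  map_id : ∀ (i : I) (n : obj i), map (𝟙 i) n = op (R.eta i : R.obj i) • n
  map_comp : ∀ {i j k : I} (α : i ⟶ j) (β : j ⟶ k) (n : obj k),
    map (α ≫ β) n = map α (map β (op (R.tau α β : R.obj k) • n))

namespace RightRep

variable {R}

/-- Morphisms of right representations. -/
@[ext]
structure Hom (N N' : RightRep R) where
  app : ∀ i : I, N.obj i →ₗ[(R.obj i)ᵐᵒᵖ] N'.obj i
  naturality : ∀ {i j : I} (α : i ⟶ j) (n : N.obj j),
    app i (N.map α n) = N'.map α (app j n)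

instance : Category (RightRep R) where
  Hom := Hom
  id N := ⟨fun _ => LinearMap.id, fun _ _ => rfl⟩
  comp f g := ⟨fun i => (g.app i).comp (f.app i), fun α m => by
    simp [f.naturality, g.naturality]⟩

/-- Short exact sequences in the category of right representations (exactness is
componentwise). -/
def ShortExact {N N' N'' : RightRep R} (f : N ⟶ N') (g : N' ⟶ N'') : Prop :=
  ∀ i : I, IsShortExact (Hom.app f i).toAddMonoidHom (Hom.app g i).toAddMonoidHom

end RightRep

/-! ### The functor `Hom(M, -)` and the tensor product functor, its left adjoint -/

section HomModule

/-- The abelian group `Hom_ℤ(M, G)` for a left `A`-module `M`, to be given the right `A`-module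
structure `(f a)(m) = f(a m)`. -/
def HomModule (A : Type u) [Ring A] (M : Type u) [AddCommGroup M] [Module A M]
    (G : Type u) [AddCommGroup G] : Type u :=
  M →+ G

variable (A : Type u) [Ring A] (M : Type u) [AddCommGroup M] [Module A M]
  (G : Type u) [AddCommGroup G]

instance : AddCommGroup (HomModule A M G) := inferInstanceAs (AddCommGroup (M →+ G))

instance : FunLike (HomModule A M G) M G := inferInstanceAs (FunLike (M →+ G) M G)

instance : AddMonoidHomClass (HomModule A M G) M G :=
  inferInstanceAs (AddMonoidHomClass (M →+ G) M G)

variable {A M G}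

@[ext]
theorem HomModule.ext {f g : HomModule A M G} (h : ∀ m, f m = g m) : f = g := DFunLike.ext f g h

@[simp]
theorem HomModule.add_apply (f g : HomModule A M G) (m : M) : (f + g) m = f m + g m := rfl

@[simp]
theorem HomModule.zero_apply (m : M) : (0 : HomModule A M G) m = 0 := rfl

instance : SMul Aᵐᵒᵖ (HomModule A M G) where
  smul a f := AddMonoidHom.comp (f : M →+ G) (DistribSMul.toAddMonoidHom M a.unop)

@[simp]
theorem HomModule.smul_apply (a : Aᵐᵒᵖ) (f : HomModule A M G) (m : M) :
    (a • f) m = f (a.unop • m) := rfl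

instance : Module Aᵐᵒᵖ (HomModule A M G) where
  one_smul f := by ext m; simp
  mul_smul a b f := by ext m; simp [mul_smul]
  smul_zero a := by ext m; simp
  smul_add a f g := by ext m; simp
  add_smul a b f := by ext m; simp [add_smul]
  zero_smul f := by ext m; simp

end HomModule

namespace LeftRep

variable {R}

/-- The right representation `Hom(M, G)` with components `Hom_ℤ(M_i, G)`, and with structural
morphisms given by precomposition with those of `M`. -/
def homRep (M : LeftRep R) (G : Type u) [AddCommGroup G] : RightRep R where
  obj i := ModuleCat.of (R.obj i)ᵐᵒᵖ (HomModule (R.obj i) (M.obj i) G)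
  map {i j} α :=
    { toFun := fun (n : HomModule (R.obj j) (M.obj j) G) =>
        (AddMonoidHom.comp (n : M.obj j →+ G) (M.map α).toAddMonoidHom :
          HomModule (R.obj i) (M.obj i) G)
      map_zero' := rfl
      map_add' := fun _ _ => rfl }
  map_smul {i j} α a n := by
    refine HomModule.ext (A := R.obj i) fun m => ?_
    change (n : HomModule (R.obj j) (M.obj j) G) (R.map α a • M.map α m) =
      (n : HomModule (R.obj j) (M.obj j) G) (M.map α (a • m))
    rw [LinearMap.map_smulₛₗ]
  map_id i n := by
    refine HomModule.ext (A := R.obj i) fun m => ?_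
    change (n : HomModule (R.obj i) (M.obj i) G) (M.map (𝟙 i) m) =
      (n : HomModule (R.obj i) (M.obj i) G) ((R.eta i : R.obj i) • m)
    rw [M.map_id]
  map_comp {i j k} α β n := by
    refine HomModule.ext (A := R.obj i) fun m => ?_
    change (n : HomModule (R.obj k) (M.obj k) G) (M.map (α ≫ β) m) =
      (n : HomModule (R.obj k) (M.obj k) G) ((R.tau α β : R.obj k) • M.map β (M.map α m))
    rw [M.map_comp]

/-- The functor `Hom(M, -)` from abelian groups to right representations. -/
def homFunctor (M : LeftRep R) : AddCommGrpCat.{u} ⥤ RightRep R where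
  obj G := M.homRep G
  map {G G'} f :=
    { app := fun i =>
        { toFun := fun (h : HomModule (R.obj i) (M.obj i) G) =>
            (AddMonoidHom.comp f.hom (h : M.obj i →+ G) : HomModule (R.obj i) (M.obj i) G')
          map_add' := fun (h h' : HomModule (R.obj i) (M.obj i) G) =>
            HomModule.ext (A := R.obj i) fun m => map_add f.hom (h m) (h' m)
          map_smul' := fun a h => rfl }
      naturality := fun α n => rfl }

section Tensor

open Classical in
/-- The subgroup of `⨁ i, N_i ⊗_{R_i} M_i` generated by all elements
`N_α(n) ⊗ m - n ⊗ M_α(m)`, where `α : i ⟶ j`, `n ∈ N_j` and `m ∈ M_i`. -/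
def tensorRel (M : LeftRep R) (N : RightRep R) :
    AddSubgroup (⨁ i : I, RingTensor (R.obj i) (N.obj i) (M.obj i)) :=
  AddSubgroup.closure
    {x | ∃ (i j : I) (α : i ⟶ j) (n : N.obj j) (m : M.obj i),
      x = DirectSum.of (fun i : I => RingTensor (R.obj i) (N.obj i) (M.obj i)) i
            (RingTensor.tmul (R.obj i) (N.map α n) m) -
          DirectSum.of (fun i : I => RingTensor (R.obj i) (N.obj i) (M.obj i)) j
            (RingTensor.tmul (R.obj j) n (M.map α m))}

/-- The tensor product `M ⊗_R N` of a left and a right representation. -/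
def tensor (M : LeftRep R) (N : RightRep R) : Type u :=
  (⨁ i : I, RingTensor (R.obj i) (N.obj i) (M.obj i)) ⧸ M.tensorRel N

instance (M : LeftRep R) (N : RightRep R) : AddCommGroup (M.tensor N) :=
  inferInstanceAs (AddCommGroup (_ ⧸ M.tensorRel N))

open Classical in
/-- The canonical map from `N_i ⊗_{R_i} M_i` to `M ⊗_R N`. -/
def tensorOf (M : LeftRep R) (N : RightRep R) (i : I) :
    RingTensor (R.obj i) (N.obj i) (M.obj i) →+ M.tensor N :=
  (QuotientAddGroup.mk' (M.tensorRel N)).comp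
    (DirectSum.of (fun i : I => RingTensor (R.obj i) (N.obj i) (M.obj i)) i)

variable (M : LeftRep R)

theorem tensorOf_balanced {N : RightRep R} {i j : I} (α : i ⟶ j) (n : N.obj j) (m : M.obj i) :
    M.tensorOf N i (RingTensor.tmul (R.obj i) (N.map α n) m) =
      M.tensorOf N j (RingTensor.tmul (R.obj j) n (M.map α m)) :=
  QuotientAddGroup.eq_iff_sub_mem.2 (AddSubgroup.subset_closure ⟨i, j, α, n, m, rfl⟩)

theorem tensor_hom_ext {N : RightRep R} {G : Type u} [AddCommGroup G] {f g : M.tensor N →+ G}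
    (h : ∀ i n m, f (M.tensorOf N i (RingTensor.tmul (R.obj i) n m)) =
      g (M.tensorOf N i (RingTensor.tmul (R.obj i) n m))) : f = g := by
  classical
  refine QuotientAddGroup.addMonoidHom_ext _ (DirectSum.addHom_ext fun i x => ?_)
  induction x using RingTensor.induction_on with
  | zero => simp
  | tmul n m => exact h i n m
  | add x y hx hy => rw [map_add, map_add, map_add, hx, hy]

open Classical in
/-- The additive map out of `M ⊗_R N` induced by a compatible family of maps. -/
def tensorLift {N : RightRep R} {G : Type u} [AddCommGroup G]
    (f : ∀ i, RingTensor (R.obj i) (N.obj i) (M.obj i) →+ G)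
    (hf : ∀ (i j : I) (α : i ⟶ j) (n : N.obj j) (m : M.obj i),
      f i (RingTensor.tmul (R.obj i) (N.map α n) m) =
        f j (RingTensor.tmul (R.obj j) n (M.map α m))) : M.tensor N →+ G :=
  QuotientAddGroup.lift (M.tensorRel N) (DirectSum.toAddMonoid f) <| by
    unfold tensorRel
    rw [AddSubgroup.closure_le]
    rintro _ ⟨i, j, α, n, m, rfl⟩
    simp [hf]

@[simp]
theorem tensorLift_of {N : RightRep R} {G : Type u} [AddCommGroup G]
    (f : ∀ i, RingTensor (R.obj i) (N.obj i) (M.obj i) →+ G)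
    (hf : ∀ (i j : I) (α : i ⟶ j) (n : N.obj j) (m : M.obj i),
      f i (RingTensor.tmul (R.obj i) (N.map α n) m) =
        f j (RingTensor.tmul (R.obj j) n (M.map α m))) (i : I)
    (x : RingTensor (R.obj i) (N.obj i) (M.obj i)) :
    M.tensorLift f hf (M.tensorOf N i x) = f i x := by
  classical
  exact DirectSum.toAddMonoid_of f i x

/-- The map `M ⊗_R N → M ⊗_R N'` induced by a morphism `N → N'`. -/
def tensorMap {N N' : RightRep R} (f : N ⟶ N') : M.tensor N →+ M.tensor N' :=
  M.tensorLift (fun i => (M.tensorOf N' i).comp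
    (RingTensor.mapLeft (R.obj i) (M.obj i) (RightRep.Hom.app f i))) fun i j α n m => by
      simp only [AddMonoidHom.comp_apply, RingTensor.mapLeft_tmul]
      rw [RightRep.Hom.naturality f, tensorOf_balanced]

@[simp]
theorem tensorMap_of {N N' : RightRep R} (f : N ⟶ N') (i : I) (n : N.obj i) (m : M.obj i) :
    M.tensorMap f (M.tensorOf N i (RingTensor.tmul (R.obj i) n m)) =
      M.tensorOf N' i (RingTensor.tmul (R.obj i) (RightRep.Hom.app f i n) m) :=
  M.tensorLift_of _ _ i _

/-- The tensor product functor `M ⊗_R -` from right representations to abelian groups. -/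
def tensorFunctor : RightRep R ⥤ AddCommGrpCat.{u} where
  obj N := AddCommGrpCat.of (M.tensor N)
  map f := AddCommGrpCat.ofHom (M.tensorMap f)
  map_id N := by
    ext1
    exact M.tensor_hom_ext fun i n m => M.tensorMap_of (𝟙 N) i n m
  map_comp f g := by
    ext1
    refine M.tensor_hom_ext fun i n m => ?_
    refine (M.tensorMap_of (f ≫ g) i n m).trans (Eq.symm ?_)
    exact (congrArg (M.tensorMap g) (M.tensorMap_of f i n m)).trans (M.tensorMap_of g i _ m)

/-- The morphism `N → Hom(M, G)` corresponding to an additive map `M ⊗_R N → G`. -/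
def curry {N : RightRep R} {G : AddCommGrpCat.{u}} (f : M.tensor N →+ G) :
    N ⟶ M.homFunctor.obj G where
  app i :=
    { toFun := fun n => (((f.comp (M.tensorOf N i)).comp (RingTensor.mk (R.obj i) n) :
        M.obj i →+ G) : HomModule (R.obj i) (M.obj i) G)
      map_add' := fun n n' => by
        refine HomModule.ext (A := R.obj i) fun m => ?_
        change f (M.tensorOf N i (RingTensor.tmul (R.obj i) (n + n') m)) =
          f (M.tensorOf N i (RingTensor.tmul (R.obj i) n m)) +
          f (M.tensorOf N i (RingTensor.tmul (R.obj i) n' m))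
        rw [RingTensor.add_tmul, map_add, map_add]
      map_smul' := fun a n => by
        refine HomModule.ext (A := R.obj i) fun m => ?_
        change f (M.tensorOf N i (RingTensor.tmul (R.obj i) (op a.unop • n) m)) =
          f (M.tensorOf N i (RingTensor.tmul (R.obj i) n (a.unop • m)))
        rw [RingTensor.smul_tmul] }
  naturality {i j} α n := by
    refine HomModule.ext (A := R.obj i) fun m => ?_
    change f (M.tensorOf N i (RingTensor.tmul (R.obj i) (N.map α n) m)) =
      f (M.tensorOf N j (RingTensor.tmul (R.obj j) n (M.map α m)))
    rw [tensorOf_balanced]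

/-- The additive map `M ⊗_R N → G` corresponding to a morphism `N → Hom(M, G)`. -/
def uncurry {N : RightRep R} {G : AddCommGrpCat.{u}} (g : N ⟶ M.homFunctor.obj G) :
    M.tensor N →+ G :=
  M.tensorLift
    (fun i => RingTensor.lift (R.obj i)
      (show N.obj i →+ (M.obj i →+ G) from (RightRep.Hom.app g i).toAddMonoidHom)
      fun n a m => congrArg (fun h : HomModule (R.obj i) (M.obj i) G => h m)
        ((RightRep.Hom.app g i).map_smul (op a) n))
    fun i _ α n m => congrArg (fun h : HomModule (R.obj i) (M.obj i) G => h m)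
      (RightRep.Hom.naturality g α n)

theorem uncurry_of {N : RightRep R} {G : AddCommGrpCat.{u}} (g : N ⟶ M.homFunctor.obj G) (i : I)
    (n : N.obj i) (m : M.obj i) :
    M.uncurry g (M.tensorOf N i (RingTensor.tmul (R.obj i) n m)) =
      (show HomModule (R.obj i) (M.obj i) G from RightRep.Hom.app g i n) m :=
  M.tensorLift_of _ _ i _

/-- The tensor product functor `M ⊗_R -` is left adjoint to `Hom(M, -)`. -/
def tensorHomAdjunction : M.tensorFunctor ⊣ M.homFunctor :=
  Adjunction.mkOfHomEquiv
    { homEquiv := fun N G =>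
        { toFun := fun f => M.curry f.hom
          invFun := fun g => AddCommGrpCat.ofHom (M.uncurry g)
          left_inv := fun f => by
            ext1
            exact M.tensor_hom_ext fun i n m => M.uncurry_of _ i n m
          right_inv := fun g => by
            refine RightRep.Hom.ext (funext fun i => LinearMap.ext fun n =>
              HomModule.ext (A := R.obj i) fun m => ?_)
            exact M.uncurry_of g i n m }
      homEquiv_naturality_left_symm := fun {N N' G} f g => by
        ext1
        refine M.tensor_hom_ext fun i n m => ?_
        refine (M.uncurry_of (f ≫ g) i n m).trans (Eq.symm ?_)
        exact (congrArg (M.uncurry g) (M.tensorMap_of f i n m)).trans (M.uncurry_of g i _ m)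
      homEquiv_naturality_right := fun f g => rfl }

end Tensor

end LeftRep

/-- The categorically flat left representations: those `M` whose tensor product functor `M ⊗_R -`
is exact. -/
def flatObjects : ObjectProperty (LeftRep R) := fun M =>
  ∀ (N N' N'' : RightRep R) (f : N ⟶ N') (g : N' ⟶ N''), RightRep.ShortExact f g →
    IsShortExact (M.tensorFunctor.map f).hom (M.tensorFunctor.map g).hom

end

end DiagRep

/-!
The proof rests on the character representation `Hom_ℤ(M, ℚ/ℤ)`, a right representation for which
morphisms `N ⟶ Hom_ℤ(M, ℚ/ℤ)` are the characters of `M ⊗_R N`.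

*The latching condition implies flatness.*  The functor `M ⊗_R -` is right exact, and it preserves
monomorphisms as soon as morphisms to `Hom_ℤ(M, ℚ/ℤ)` extend along componentwise monomorphisms
`N → N'`.  Such an extension is built by well-founded recursion over the direct category
(`LeftRep.exists_extension_of_phi`).  At the object `i`, the components already constructed amount
to an `R_i`-linear map `N'_i → Hom_ℤ(L_i(M), ℚ/ℤ)`, by the universal property of the latching module
(`LeftRep.exists_latching_lift`), and it has to be lifted to `Hom_ℤ(M_i, ℚ/ℤ)` compatibly with the
map given on `N_i`.  This is possible (`flatModules.exists_lift`): the restriction map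
`Hom_ℤ(M_i, ℚ/ℤ) → Hom_ℤ(L_i(M), ℚ/ℤ)` is surjective because `φ_i` is injective, and its kernel
`Hom_ℤ(coker φ_i, ℚ/ℤ)` is an injective right module because `coker φ_i` is flat.

*Flatness implies the latching condition.*  For a right `R_i`-module `X`, let `F` be the free right
representation on `X` placed at `i`; its component at `h` is a sum of copies of `X` indexed by the
morphisms `h ⟶ i`.  As `I` is direct, `F` has a subrepresentation `F'` which agrees with `F` away
from `i` and vanishes at `i`, and the quotient `F/F'` is `X` at `i` and zero elsewhere.  Tensoring
`F'`, `F` and `F/F'` with `M` gives `X ⊗ L_i(M)`, `X ⊗ M_i` and `X ⊗ coker φ_i`.  Hence exactness of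
`M ⊗_R -` on `0 → F' → F → F/F' → 0` for `X = R_i` shows that `φ_i` is injective
(`LeftRep.mono_latchingMap_of_flat`), and its exactness on the representations `F/F'`, as `X`
varies, shows that `coker φ_i` is flat (`LeftRep.flat_cokernel_of_flat`).
-/

namespace DiagRep

noncomputable section

/-! ### An injective cogenerator of abelian groups -/

/-- The group `ℚ/ℤ`, lifted to the universe `u` so that it can be a target of `RingTensor.lift` and
of `HomModule`. -/
def QmodZ : Type u := ULift.{u} (AddCircle (1 : ℚ))

instance : AddCommGroup QmodZ.{u} := inferInstanceAs (AddCommGroup (ULift (AddCircle (1 : ℚ))))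

theorem QmodZ.exists_extension {A B : Type u} [AddCommGroup A] [AddCommGroup B] (f : A →+ B)
    (hf : Function.Injective f) (g : A →+ QmodZ.{u}) :
    ∃ h : B →+ QmodZ.{u}, ∀ a, h (f a) = g a := by
  let e : QmodZ.{u} ≃+ AddCircle (1 : ℚ) := AddEquiv.ulift
  obtain ⟨h, hh⟩ := CharacterModule.dual_surjective_of_injective f.toIntLinearMap hf
    (e.toAddMonoidHom.comp g : A →+ AddCircle (1 : ℚ))
  refine ⟨e.symm.toAddMonoidHom.comp (h : B →+ AddCircle (1 : ℚ)), fun a => ?_⟩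
  have := DFunLike.congr_fun hh a
  exact (congrArg e.symm this).trans (e.symm_apply_apply (g a))

theorem QmodZ.exists_apply_ne_zero {A : Type u} [AddCommGroup A] {a : A} (ha : a ≠ 0) :
    ∃ c : A →+ QmodZ.{u}, c a ≠ 0 := by
  let e : QmodZ.{u} ≃+ AddCircle (1 : ℚ) := AddEquiv.ulift
  obtain ⟨c, hc⟩ := CharacterModule.exists_character_apply_ne_zero_of_ne_zero ha
  refine ⟨e.symm.toAddMonoidHom.comp (c : A →+ AddCircle (1 : ℚ)), fun h => hc ?_⟩
  exact e.symm.map_eq_zero_iff.1 h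

/-! ### Extending balanced maps along a monomorphism with flat cokernel -/

section Ring

variable {A : Type u} [Ring A]

theorem RingTensor.addHom_ext {N M G : Type u} [AddCommGroup N] [Module Aᵐᵒᵖ N] [AddCommGroup M]
    [Module A M] [AddCommGroup G] {f g : RingTensor A N M →+ G}
    (h : ∀ n m, f (RingTensor.tmul A n m) = g (RingTensor.tmul A n m)) : f = g := by
  ext x
  induction x using RingTensor.induction_on with
  | zero => simp
  | tmul n m => exact h n m
  | add x y hx hy => rw [map_add, map_add, hx, hy]

variable {X Y : Type u} [AddCommGroup X] [Module Aᵐᵒᵖ X] [AddCommGroup Y] [Module Aᵐᵒᵖ Y]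
  {L P G : Type u} [AddCommGroup L] [Module A L] [AddCommGroup P] [Module A P] [AddCommGroup G]

/-- Precomposition `Hom_ℤ(P, G) → Hom_ℤ(L, G)` with an `A`-linear map `L → P`. -/
def HomModule.precomp (G : Type u) [AddCommGroup G] (φ : L →ₗ[A] P) :
    HomModule A P G →ₗ[Aᵐᵒᵖ] HomModule A L G where
  toFun p := (AddMonoidHom.comp (p : P →+ G) φ.toAddMonoidHom : HomModule A L G)
  map_add' _ _ := rfl
  map_smul' a p := HomModule.ext fun l => congrArg p (φ.map_smul a.unop l).symm

/-- A balanced map `X × P → G` vanishing on the kernel of a surjection `π : P → C` descends to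
`X ⊗_A C`. -/
theorem RingTensor.exists_descend {C : Type u} [AddCommGroup C] [Module A C] (π : P →ₗ[A] C)
    (hπ : Function.Surjective π) (g : X →ₗ[Aᵐᵒᵖ] HomModule A P G)
    (hg : ∀ x p, π p = 0 → g x p = 0) :
    ∃ t : RingTensor A X C →+ G, ∀ x p, t (RingTensor.tmul A x (π p)) = g x p := by
  let s : X → C →+ G := fun x =>
    π.toAddMonoidHom.liftOfSurjective hπ ⟨(g x : P →+ G), fun p hp => hg x p hp⟩
  have hs : ∀ x p, s x (π p) = g x p := fun x p =>
    AddMonoidHom.liftOfRightInverse_comp_apply _ _ _ _ _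
  let b : X →+ C →+ G := AddMonoidHom.mk' s fun x x' => by
    ext c
    obtain ⟨p, rfl⟩ := hπ c
    rw [AddMonoidHom.add_apply, hs, hs, hs, map_add, HomModule.add_apply]
  refine ⟨RingTensor.lift A b fun x a c => ?_, hs⟩
  obtain ⟨p, rfl⟩ := hπ c
  change s (op a • x) (π p) = s x (a • π p)
  rw [← map_smul, hs, hs, map_smul, HomModule.smul_apply, unop_op]

theorem flatModules.exists_extension {C : ModuleCat.{u} A} (hC : flatModules A C)
    (f : X →ₗ[Aᵐᵒᵖ] Y) (hf : Function.Injective f) (t : RingTensor A X C →+ QmodZ.{u}) :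
    ∃ s : RingTensor A Y C →+ QmodZ.{u},
      ∀ x c, s (RingTensor.tmul A (f x) c) = t (RingTensor.tmul A x c) := by
  have h := hC (ModuleCat.of _ X) (ModuleCat.of _ Y) (ModuleCat.of _ (Y ⧸ LinearMap.range f))
    (ModuleCat.ofHom f) (ModuleCat.ofHom (LinearMap.range f).mkQ)
    ⟨hf, fun y => by simp, Submodule.mkQ_surjective _⟩
  obtain ⟨s, hs⟩ := QmodZ.exists_extension _ h.1 t
  exact ⟨s, fun x c => hs (RingTensor.tmul A x c)⟩

/-- For a flat quotient `π : P → C`, the submodule `Hom_ℤ(C, ℚ/ℤ)` of `Hom_ℤ(P, ℚ/ℤ)` is an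
injective right module. -/
theorem flatModules.exists_extension_vanishing {C : ModuleCat.{u} A} (hC : flatModules A C)
    (π : P →ₗ[A] C) (hπ : Function.Surjective π) (f : X →ₗ[Aᵐᵒᵖ] Y) (hf : Function.Injective f)
    (g : X →ₗ[Aᵐᵒᵖ] HomModule A P QmodZ.{u}) (hg : ∀ x p, π p = 0 → g x p = 0) :
    ∃ g' : Y →ₗ[Aᵐᵒᵖ] HomModule A P QmodZ.{u},
      (∀ x, g' (f x) = g x) ∧ ∀ y p, π p = 0 → g' y p = 0 := by
  obtain ⟨t, ht⟩ := RingTensor.exists_descend π hπ g hg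
  obtain ⟨s, hs⟩ := hC.exists_extension f hf t
  let g' : Y →ₗ[Aᵐᵒᵖ] HomModule A P QmodZ.{u} :=
    { toFun := fun y => (s.comp ((RingTensor.mk A y).comp π.toAddMonoidHom) : P →+ QmodZ.{u})
      map_add' := fun y y' => HomModule.ext fun p => by
        change s (RingTensor.tmul A (y + y') (π p)) =
          s (RingTensor.tmul A y (π p)) + s (RingTensor.tmul A y' (π p))
        rw [RingTensor.add_tmul, map_add]
      map_smul' := fun a y => HomModule.ext fun p => by
        change s (RingTensor.tmul A (op a.unop • y) (π p)) =
          s (RingTensor.tmul A y (π (a.unop • p)))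
        rw [RingTensor.smul_tmul, map_smul] }
  have hg' : ∀ y p, g' y p = s (RingTensor.mk A y (π p)) := fun _ _ => rfl
  refine ⟨g', fun x => HomModule.ext fun p => ?_, fun y p hp => ?_⟩
  · exact (hs x (π p)).trans (ht x p)
  · rw [hg', hp, map_zero, map_zero]

theorem exists_factor_of_surjective {S Z Y W : Type*} [Ring S] [AddCommGroup Z] [AddCommGroup Y]
    [AddCommGroup W] [Module S Z] [Module S Y] [Module S W] (p : Z →ₗ[S] Y)
    (hp : Function.Surjective p) (h : Z →ₗ[S] W) (hh : ∀ z, p z = 0 → h z = 0) :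
    ∃ w : Y →ₗ[S] W, ∀ z, w (p z) = h z := by
  refine ⟨((LinearMap.ker p).liftQ h hh).comp
    (p.quotKerEquivOfSurjective hp).symm.toLinearMap, fun z => ?_⟩
  have : (p.quotKerEquivOfSurjective hp).symm (p z) = (LinearMap.ker p).mkQ z := by
    rw [LinearEquiv.symm_apply_eq]; rfl
  rw [LinearMap.comp_apply, LinearEquiv.coe_coe, this]
  rfl

/-- The lifting property of the restriction map `Hom_ℤ(P, ℚ/ℤ) → Hom_ℤ(L, ℚ/ℤ)` with respect to
monomorphisms `X → Y` of right modules, when `L → P` is a monomorphism with flat cokernel `C`. -/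
theorem flatModules.exists_lift {C : ModuleCat.{u} A} (hC : flatModules A C)
    (φ : L →ₗ[A] P) (hφ : Function.Injective φ) (π : P →ₗ[A] C) (hπ : Function.Surjective π)
    (hex : Function.Exact φ π) (f : X →ₗ[Aᵐᵒᵖ] Y) (hf : Function.Injective f)
    (g : X →ₗ[Aᵐᵒᵖ] HomModule A P QmodZ.{u}) (v : Y →ₗ[Aᵐᵒᵖ] HomModule A L QmodZ.{u})
    (hgv : ∀ x l, g x (φ l) = v (f x) l) :
    ∃ w : Y →ₗ[Aᵐᵒᵖ] HomModule A P QmodZ.{u},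
      (∀ x, w (f x) = g x) ∧ ∀ y l, w y (φ l) = v y l := by
  let res := HomModule.precomp QmodZ.{u} φ
  -- `Z` is the pullback of `v` and `res`; it projects onto `Y` with kernel `ker res`.
  let Z : Submodule Aᵐᵒᵖ (Y × HomModule A P QmodZ.{u}) :=
    LinearMap.ker (v.comp (LinearMap.fst _ _ _) - res.comp (LinearMap.snd _ _ _))
  have hZ : ∀ z : Y × HomModule A P QmodZ.{u}, z ∈ Z ↔ v z.1 = res z.2 := fun z => by
    simp [Z, sub_eq_zero]
  let j : LinearMap.ker res × X →ₗ[Aᵐᵒᵖ] Z := LinearMap.codRestrict Z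
    ((f.comp (LinearMap.snd _ _ _)).prod
      ((LinearMap.ker res).subtype.coprod g)) fun c => (hZ _).2 <| by
        have h0 : res (c.1 : HomModule A P QmodZ.{u}) = 0 := c.1.2
        have : v (f c.2) = res (g c.2) := HomModule.ext fun l => (hgv c.2 l).symm
        simp [h0, this]
  have hj : Function.Injective j := by
    rw [← LinearMap.ker_eq_bot, LinearMap.ker_eq_bot']
    rintro ⟨k, x⟩ h
    have h' := congrArg Subtype.val h
    have h1 : f x = 0 := congrArg Prod.fst h'
    have h2 : (k : HomModule A P QmodZ.{u}) + g x = 0 := congrArg Prod.snd h'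
    have hx : x = 0 := hf (h1.trans (map_zero f).symm)
    subst hx
    rw [map_zero, add_zero] at h2
    exact Prod.ext (Subtype.ext h2) rfl
  -- `ρ` is a retraction of `Z` onto `ker res` that vanishes on the image of `X`.
  obtain ⟨ρ, hρ, hρ'⟩ := hC.exists_extension_vanishing π hπ j hj
    ((LinearMap.ker res).subtype.comp (LinearMap.fst _ _ _)) fun c p hp => by
      obtain ⟨l, rfl⟩ := (hex p).1 hp
      exact DFunLike.congr_fun (show res (c.1 : HomModule A P QmodZ.{u}) = 0 from c.1.2) l
  obtain ⟨w, hw⟩ := exists_factor_of_surjective ((LinearMap.fst _ _ _).comp Z.subtype)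
    (fun y => by
      obtain ⟨p, hp⟩ := QmodZ.exists_extension φ.toAddMonoidHom hφ (v y : L →+ QmodZ.{u})
      exact ⟨⟨(y, p), (hZ _).2 (HomModule.ext fun l => (hp l).symm)⟩, rfl⟩)
    ((LinearMap.snd _ _ _).comp Z.subtype - ρ) (by
      rintro ⟨⟨y, p⟩, hz⟩ (rfl : y = 0)
      have hp : res p = 0 := by rw [← (hZ _).1 hz, map_zero]
      have : (⟨(0, p), hz⟩ : Z) = j (⟨p, hp⟩, 0) := Subtype.ext (by simp [j])
      rw [LinearMap.sub_apply, this, hρ]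
      simp [j])
  refine ⟨w, fun x => ?_, fun y l => ?_⟩
  · have h := hw (j (0, x))
    rw [LinearMap.sub_apply, hρ] at h
    simpa [j] using h
  · obtain ⟨(p : HomModule A P QmodZ.{u}), hp⟩ :=
      QmodZ.exists_extension φ.toAddMonoidHom hφ (v y : L →+ QmodZ.{u})
    have hz : ((y, p) : Y × HomModule A P QmodZ.{u}) ∈ Z :=
      (hZ _).2 (HomModule.ext fun l => (hp l).symm)
    have h : w y = p - ρ ⟨(y, p), hz⟩ := hw ⟨(y, p), hz⟩
    have h1 : ρ ⟨(y, p), hz⟩ (φ l) = 0 := hρ' _ _ ((hex _).2 ⟨l, rfl⟩)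
    have h2 : w y (φ l) + ρ ⟨(y, p), hz⟩ (φ l) = p (φ l) := by
      rw [← HomModule.add_apply, h, sub_add_cancel]
    rw [h1, add_zero] at h2
    exact h2.trans (hp l)

end Ring

section

/-! ### Balanced maps out of latching modules -/

section LeftHom

/-- The abelian group `Hom_ℤ(X, G)` for a right `A`-module `X`, to be given the left `A`-module
structure `(a f)(x) = f(x a)`. -/
def LeftHomModule (A : Type u) [Ring A] (X : Type u) [AddCommGroup X] [Module Aᵐᵒᵖ X]
    (G : Type u) [AddCommGroup G] : Type u :=
  X →+ G

variable (A : Type u) [Ring A] (X : Type u) [AddCommGroup X] [Module Aᵐᵒᵖ X]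
  (G : Type u) [AddCommGroup G]

instance : AddCommGroup (LeftHomModule A X G) := inferInstanceAs (AddCommGroup (X →+ G))

instance : FunLike (LeftHomModule A X G) X G := inferInstanceAs (FunLike (X →+ G) X G)

instance : AddMonoidHomClass (LeftHomModule A X G) X G :=
  inferInstanceAs (AddMonoidHomClass (X →+ G) X G)

variable {A X G}

theorem LeftHomModule.ext {f g : LeftHomModule A X G} (h : ∀ x, f x = g x) : f = g :=
  DFunLike.ext f g h

@[simp]
theorem LeftHomModule.add_apply (f g : LeftHomModule A X G) (x : X) : (f + g) x = f x + g x := rfl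

@[simp]
theorem LeftHomModule.zero_apply (x : X) : (0 : LeftHomModule A X G) x = 0 := rfl

instance : SMul A (LeftHomModule A X G) where
  smul a f := AddMonoidHom.comp (f : X →+ G) (DistribSMul.toAddMonoidHom X (op a))

@[simp]
theorem LeftHomModule.smul_apply (a : A) (f : LeftHomModule A X G) (x : X) :
    (a • f) x = f (op a • x) := rfl

instance : Module A (LeftHomModule A X G) where
  one_smul f := LeftHomModule.ext fun x => by simp
  mul_smul a b f := LeftHomModule.ext fun x => by simp [mul_smul]
  smul_zero a := LeftHomModule.ext fun x => by simp
  smul_add a f g := LeftHomModule.ext fun x => by simp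
  add_smul a b f := LeftHomModule.ext fun x => by simp [add_smul]
  zero_smul f := LeftHomModule.ext fun x => by simp

end LeftHom

variable {I : Type u} [SmallCategory I] {R : RingDiagram I}

namespace LeftRep

variable (M : LeftRep R)

/-- The map from `R_i ⊗_{R_h} M_h` to the latching module `L_i(M)` at `α : h ⟶ i`, `h ≠ i`. -/
def toLatching {h i : I} (α : h ⟶ i) (hα : h ≠ i) :
    BaseChange (R.map α) (M.obj h) →ₗ[R.obj i] M.latching i :=
  (colimit.ι (M.latchingDiagram i) ⟨Over.mk α, hα⟩).hom

theorem toLatching_comp {h k i : I} (γ : h ⟶ k) (δ : k ⟶ i) (hγδ : h ≠ i) (hδ : k ≠ i)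
    (r : R.obj i) (m : M.obj h) :
    M.toLatching (γ ≫ δ) hγδ (BaseChange.tmul _ r m) =
      M.toLatching δ hδ (BaseChange.tmul _ (r * R.tau γ δ) (M.map γ m)) := by
  have h := colimit.w (M.latchingDiagram i)
    (ObjectProperty.homMk (Over.homMk γ) :
      (⟨Over.mk (γ ≫ δ), hγδ⟩ : LatchingIndex i) ⟶ ⟨Over.mk δ, hδ⟩)
  exact (LinearMap.congr_fun (congrArg ModuleCat.Hom.hom h) (BaseChange.tmul _ r m)).symm

theorem latchingMap_toLatching {h i : I} (α : h ⟶ i) (hα : h ≠ i) (r : R.obj i) (m : M.obj h) :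
    (M.latchingMap i).hom (M.toLatching α hα (BaseChange.tmul _ r m)) = r • M.map α m := by
  have h := colimit.ι_desc (M.latchingCocone i) (⟨Over.mk α, hα⟩ : LatchingIndex i)
  exact LinearMap.congr_fun (congrArg ModuleCat.Hom.hom h) (BaseChange.tmul _ r m)

theorem latching_addHom_ext {i : I} {G : Type*} [AddCommGroup G] {f g : M.latching i →+ G}
    (H : ∀ {h : I} (α : h ⟶ i) (hα : h ≠ i) (r : R.obj i) (m : M.obj h),
      f (M.toLatching α hα (BaseChange.tmul _ r m)) =
        g (M.toLatching α hα (BaseChange.tmul _ r m))) : f = g := by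
  let S : Submodule (R.obj i) (M.latching i) := Submodule.span _
    {l | ∃ (h : I) (α : h ⟶ i) (hα : h ≠ i) (m : M.obj h),
      l = M.toLatching α hα (BaseChange.tmul _ 1 m)}
  have hS : ModuleCat.ofHom S.mkQ = 0 := by
    refine colimit.hom_ext fun α => ?_
    ext1
    refine BaseChange.hom_ext _ fun m => ?_
    exact (Submodule.Quotient.mk_eq_zero S).2
      (Submodule.subset_span ⟨α.obj.left, α.obj.hom, α.property, m, rfl⟩)
  ext l
  have hl : l ∈ S := (Submodule.Quotient.mk_eq_zero S).1
    (LinearMap.congr_fun (congrArg ModuleCat.Hom.hom hS) l)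
  suffices ∀ r : R.obj i, f (r • l) = g (r • l) by simpa using this 1
  induction hl using Submodule.span_induction with
  | mem l hl =>
    obtain ⟨h, α, hα, m, rfl⟩ := hl
    intro r
    rw [← map_smul, BaseChange.smul_tmul]
    exact H _ _ _ _
  | zero => simp
  | add l l' _ _ hl hl' => intro r; rw [smul_add, map_add, map_add, hl, hl']
  | smul a l _ hl => intro r; rw [smul_smul, hl]

/-- The universal property of `X ⊗_{R_i} L_i(M)`, for a right `R_i`-module `X`: a balanced map
`X × L_i(M) → G` amounts to balanced maps `X × M_h → G` for all `α : h ⟶ i` with `h ≠ i`, where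
`R_h` acts on `X` through `α`, compatible with the structural maps of `M`. -/
theorem exists_latching_lift {i : I} {X G : Type u} [AddCommGroup X] [Module (R.obj i)ᵐᵒᵖ X]
    [AddCommGroup G] (b : ∀ {h : I} (_ : h ⟶ i) (_ : h ≠ i), X →+ M.obj h →+ G)
    (hb : ∀ {h : I} (α : h ⟶ i) (hα : h ≠ i) (x : X) (a : R.obj h) (m : M.obj h),
      b α hα (op (R.map α a) • x) m = b α hα x (a • m))
    (hb' : ∀ {h k : I} (γ : h ⟶ k) (δ : k ⟶ i) (hγδ : h ≠ i) (hδ : k ≠ i) (x : X) (m : M.obj h),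
      b δ hδ (op (R.tau γ δ : R.obj i) • x) (M.map γ m) = b (γ ≫ δ) hγδ x m) :
    ∃ v : X →ₗ[(R.obj i)ᵐᵒᵖ] HomModule (R.obj i) (M.latching i) G,
      ∀ {h : I} (α : h ⟶ i) (hα : h ≠ i) (x : X) (r : R.obj i) (m : M.obj h),
        v x (M.toLatching α hα (BaseChange.tmul _ r m)) = b α hα (op r • x) m := by
  -- The maps `b α` form a cocone with apex `Hom_ℤ(X, G)`, a left `R_i`-module; the induced map
  -- `L_i(M) → Hom_ℤ(X, G)` is then read as a map on `X`.
  let c (α : LatchingIndex i) :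
      M.obj α.obj.left →ₛₗ[R.map α.obj.hom] LeftHomModule (R.obj i) X G :=
    { toFun := fun m => (b α.obj.hom α.property).flip m
      map_add' := fun m m' => map_add _ m m'
      map_smul' := fun a m => LeftHomModule.ext (A := R.obj i) fun x =>
        (hb α.obj.hom α.property x a m).symm }
  have hc : ∀ α m x, c α m x = b α.obj.hom α.property x m := fun _ _ _ => rfl
  let s : Cocone (M.latchingDiagram i) :=
    { pt := ModuleCat.of _ (LeftHomModule (R.obj i) X G)
      ι :=
        { app := fun α => ModuleCat.ofHom (BaseChange.lift _ (c α))
          naturality := fun α α' γ => by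
            ext1
            refine BaseChange.hom_ext _ fun m => LeftHomModule.ext (A := R.obj i) fun x => ?_
            change BaseChange.lift _ (c α') ((1 : R.obj i) • BaseChange.tmul _
                (R.tau γ.hom.left α'.obj.hom : R.obj i) (M.map γ.hom.left m)) x =
              ((1 : R.obj i) • c α m) x
            rw [one_smul, one_smul, BaseChange.lift_tmul, LeftHomModule.smul_apply, hc, hc,
              hb' γ.hom.left α'.obj.hom α.property α'.property, Over.w] } }
  let d : M.latching i →ₗ[R.obj i] LeftHomModule (R.obj i) X G := (colimit.desc _ s).hom
  have hd : ∀ {h : I} (α : h ⟶ i) (hα : h ≠ i) (x : X) (r : R.obj i) (m : M.obj h),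
      d (M.toLatching α hα (BaseChange.tmul _ r m)) x = b α hα (op r • x) m := by
    intro h α hα x r m
    have h := colimit.ι_desc s (⟨Over.mk α, hα⟩ : LatchingIndex i)
    exact DFunLike.congr_fun
      (LinearMap.congr_fun (congrArg ModuleCat.Hom.hom h) (BaseChange.tmul _ r m)) x
  refine ⟨
    { toFun := fun x => ((show M.latching i →+ (X →+ G) from d.toAddMonoidHom).flip x :)
      map_add' := fun x x' => map_add _ x x'
      map_smul' := fun a x => HomModule.ext fun l => ?_ }, fun α hα x r m => hd α hα x r m⟩
  exact (DFunLike.congr_fun (d.map_smul a.unop l) x).symm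

/-! ### The cokernel of the latching map -/

/-- The projection of `M_i` onto the cokernel of the latching map. -/
def latchingπ (i : I) : M.obj i →ₗ[R.obj i] (cokernel (M.latchingMap i) : ModuleCat (R.obj i)) :=
  (cokernel.π (M.latchingMap i)).hom

theorem latchingπ_surjective (i : I) : Function.Surjective (M.latchingπ i) :=
  (ModuleCat.epi_iff_surjective _).1 inferInstance

theorem exact_latchingπ (i : I) : Function.Exact (M.latchingMap i).hom (M.latchingπ i) :=
  (ShortComplex.ShortExact.moduleCat_exact_iff_function_exact _).1
    (ShortComplex.exact_cokernel (M.latchingMap i))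

theorem latchingπ_map {h i : I} (α : h ⟶ i) (hα : h ≠ i) (m : M.obj h) :
    M.latchingπ i (M.map α m) = 0 :=
  (M.exact_latchingπ i _).2 ⟨M.toLatching α hα (BaseChange.tmul _ 1 m), by
    rw [latchingMap_toLatching, one_smul]⟩

end LeftRep

end

section

variable {I : Type u} [SmallCategory I] {R : RingDiagram I}

/-! ### Direct categories are well-founded -/

namespace IsDirectCategory

/-- In a direct category, the existence of a morphism between different objects is contained in a
well-founded relation. -/
theorem exists_wellFounded (hI : IsDirectCategory I) :
    ∃ S : I → I → Prop, WellFounded S ∧ ∀ {h i : I} (_ : h ⟶ i), h ≠ i → S h i := by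
  obtain ⟨-, ζ, F, hF⟩ := hI
  exact ⟨InvImage (· < ·) F.obj, InvImage.wf _ wellFounded_lt, fun α hne =>
    lt_of_le_of_ne (leOfHom (F.map α)) fun h => hne (hF α h).choose⟩

theorem eq_id (hI : IsDirectCategory I) {i : I} (α : i ⟶ i) : α = 𝟙 i := by
  obtain ⟨-, ζ, F, hF⟩ := hI
  exact (hF α rfl).choose_spec

theorem eq_of_hom_of_hom (hI : IsDirectCategory I) {h i : I} (α : h ⟶ i) (β : i ⟶ h) : h = i := by
  obtain ⟨S, wf, hS⟩ := hI.exists_wellFounded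
  by_contra hne
  exact wf.asymmetric _ _ (hS α hne) (hS β (Ne.symm hne))

end IsDirectCategory

/-! ### Right exactness of the tensor product -/

namespace LeftRep

variable (M : LeftRep R)

theorem exists_homRep_of_tensor {N : RightRep R} {G : Type u} [AddCommGroup G]
    (c : M.tensor N →+ G) :
    ∃ u : N ⟶ M.homRep G, ∀ i n (m : M.obj i),
      (show HomModule (R.obj i) (M.obj i) G from RightRep.Hom.app u i n) m =
        c (M.tensorOf N i (RingTensor.tmul (R.obj i) n m)) :=
  ⟨M.curry (G := AddCommGrpCat.of G) c, fun _ _ _ => rfl⟩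

theorem exists_tensor_of_homRep {N : RightRep R} {G : Type u} [AddCommGroup G]
    (u : N ⟶ M.homRep G) :
    ∃ c : M.tensor N →+ G, ∀ i n (m : M.obj i),
      c (M.tensorOf N i (RingTensor.tmul (R.obj i) n m)) =
        (show HomModule (R.obj i) (M.obj i) G from RightRep.Hom.app u i n) m :=
  ⟨M.uncurry (G := AddCommGrpCat.of G) u, fun i n m => M.uncurry_of _ i n m⟩

theorem tensorMap_surjective {N N' : RightRep R} {g : N ⟶ N'}
    (hg : ∀ i, Function.Surjective (RightRep.Hom.app g i)) :
    Function.Surjective (M.tensorMap g) := by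
  rw [← AddMonoidHom.range_eq_top, ← QuotientAddGroup.ker_mk' (M.tensorMap g).range,
    AddMonoidHom.ker_eq_top_iff]
  refine M.tensor_hom_ext fun i n m => ?_
  obtain ⟨n, rfl⟩ := hg i n
  exact (QuotientAddGroup.eq_zero_iff _).2
    ⟨M.tensorOf N i (RingTensor.tmul (R.obj i) n m), M.tensorMap_of g i n m⟩

theorem tensorMap_exact {N N' N'' : RightRep R} {f : N ⟶ N'} {g : N' ⟶ N''}
    (h : RightRep.ShortExact f g) : Function.Exact (M.tensorMap f) (M.tensorMap g) := by
  intro x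
  constructor
  · intro hx
    by_contra hne
    obtain ⟨c, hc⟩ := QmodZ.exists_apply_ne_zero
      (mt (QuotientAddGroup.eq_zero_iff (N := (M.tensorMap f).range) x).1 hne)
    -- The character `c` of the cokernel corresponds to a morphism `N' ⟶ Hom(M, ℚ/ℤ)` that vanishes
    -- on `N`, hence factors through `N''`.
    obtain ⟨u, hu⟩ := M.exists_homRep_of_tensor (c.comp (QuotientAddGroup.mk' _))
    have hw (i : I) : ∃ w : N''.obj i →ₗ[(R.obj i)ᵐᵒᵖ] HomModule (R.obj i) (M.obj i) QmodZ.{u},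
        ∀ n, w (RightRep.Hom.app g i n) = RightRep.Hom.app u i n :=
      exists_factor_of_surjective (RightRep.Hom.app g i) (h i).2.2 (RightRep.Hom.app u i) <| by
        intro n hn
        obtain ⟨n, rfl⟩ := ((h i).2.1 n).1 hn
        refine HomModule.ext (A := R.obj i) fun m => (hu i _ m).trans ?_
        exact (congrArg c ((QuotientAddGroup.eq_zero_iff _).2
          ⟨M.tensorOf N i (RingTensor.tmul (R.obj i) n m), M.tensorMap_of f i n m⟩)).trans
            (map_zero c)
    choose w hw using hw
    obtain ⟨t, ht⟩ := M.exists_tensor_of_homRep (N := N'')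
      { app := w
        naturality := fun {i j} α n => by
          obtain ⟨n, rfl⟩ := (h j).2.2 n
          change w i (N''.map α (RightRep.Hom.app g j n)) =
            (M.homRep QmodZ.{u}).map α (w j (RightRep.Hom.app g j n))
          rw [← RightRep.Hom.naturality g, hw, hw, RightRep.Hom.naturality u] }
    have htc : t.comp (M.tensorMap g) = c.comp (QuotientAddGroup.mk' _) := by
      refine M.tensor_hom_ext fun i n m => ?_
      rw [AddMonoidHom.comp_apply, tensorMap_of, ht, ← hu, ← hw]
      rfl
    refine hc ((DFunLike.congr_fun htc x).symm.trans ?_)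
    rw [AddMonoidHom.comp_apply, hx, map_zero]
  · rintro ⟨x, rfl⟩
    refine DFunLike.congr_fun (f := (M.tensorMap g).comp (M.tensorMap f)) (g := 0)
      (M.tensor_hom_ext fun i n m => ?_) x
    rw [AddMonoidHom.comp_apply, tensorMap_of, tensorMap_of,
      show RightRep.Hom.app g i (RightRep.Hom.app f i n) = 0 from ((h i).2.1 _).2 ⟨n, rfl⟩,
      ← RingTensor.mk_apply, map_zero, AddMonoidHom.zero_apply, map_zero, AddMonoidHom.zero_apply]

end LeftRep

/-! ### The latching condition implies flatness -/

namespace LeftRep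

/-- If `M` lies in `Φ(Flat)`, then `Hom_ℤ(M, ℚ/ℤ)` is an injective right representation.  The
extension is built by recursion over the direct category: the components at `h ≠ i` with a morphism
`h ⟶ i` prescribe the component at `i` on the latching module, and `flatModules.exists_lift` extends
it to `M_i`. -/
theorem exists_extension_of_phi (hI : IsDirectCategory I) {M : LeftRep R}
    (hM : Phi R (fun i => flatModules (R.obj i)) M) {N N' : RightRep R} (f : N ⟶ N')
    (hf : ∀ i, Function.Injective (RightRep.Hom.app f i)) (u : N ⟶ M.homRep QmodZ.{u}) :
    ∃ g : N' ⟶ M.homRep QmodZ.{u}, f ≫ g = u := by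
  classical
  obtain ⟨S, wf, hS⟩ := hI.exists_wellFounded
  let Γ (i : I) := N'.obj i →ₗ[(R.obj i)ᵐᵒᵖ] HomModule (R.obj i) (M.obj i) QmodZ.{u}
  let u' (i : I) : N.obj i →ₗ[(R.obj i)ᵐᵒᵖ] HomModule (R.obj i) (M.obj i) QmodZ.{u} :=
    RightRep.Hom.app u i
  have hu' : ∀ {h i : I} (α : h ⟶ i) (x : N.obj i) (m : M.obj h),
      u' h (N.map α x) m = u' i x (M.map α m) := fun α x m =>
    congrArg (fun p : HomModule _ _ QmodZ.{u} => p m) (RightRep.Hom.naturality u α x)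
  -- `Good i g w`: the component `w` at `i` extends `u` and is compatible with the components `g` at
  -- the objects below `i`.
  let Good (i : I) (g : ∀ h, S h i → Γ h) (w : Γ i) : Prop :=
    (∀ x, w (RightRep.Hom.app f i x) = u' i x) ∧
      ∀ (h : I) (α : h ⟶ i) (hα : h ≠ i) (y : N'.obj i) (m : M.obj h),
        g h (hS α hα) (N'.map α y) m = w y (M.map α m)
  -- A good component exists at each step by `key` below, so the value `0` never occurs.
  let G : ∀ i, Γ i := wf.fix fun i g => if H : ∃ w, Good i g w then H.choose else 0
  have hG : ∀ i, (∃ w, Good i (fun h _ => G h) w) → Good i (fun h _ => G h) (G i) := by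
    intro i H
    have : G i = H.choose := by
      change wf.fix _ i = _
      rw [wf.fix_eq]
      exact dif_pos H
    rw [this]
    exact H.choose_spec
  have key : ∀ i, Good i (fun h _ => G h) (G i) := by
    intro i
    induction i using wf.induction with
    | _ i ih =>
    refine hG i ?_
    let b {h : I} (α : h ⟶ i) (_ : h ≠ i) : N'.obj i →+ M.obj h →+ QmodZ.{u} :=
      (show N'.obj h →+ (M.obj h →+ QmodZ.{u}) from (G h).toAddMonoidHom).comp (N'.map α)
    have hbG : ∀ {h : I} (α : h ⟶ i) (hα : h ≠ i) y m, b α hα y m = G h (N'.map α y) m :=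
      fun _ _ _ _ => rfl
    obtain ⟨v, hv⟩ := M.exists_latching_lift b
      (fun α hα y a m => by
        rw [hbG α hα, hbG α hα, N'.map_smul, map_smul, HomModule.smul_apply, unop_op])
      (fun {h k} γ δ hγδ hδ y m => by
        rw [hbG δ hδ, hbG _ hγδ, N'.map_comp]
        by_cases hk : h = k
        · subst hk
          rw [hI.eq_id γ, N'.map_id, M.map_id, LinearMap.map_smul (G h), HomModule.smul_apply,
            unop_op]
        · exact ((ih k (hS δ hδ)).2 h γ hk _ m).symm)
    have hφ := (ModuleCat.mono_iff_injective _).1 (hM i).1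
    obtain ⟨w, hw, hw'⟩ := flatModules.exists_lift (hM i).2 (M.latchingMap i).hom hφ
      (M.latchingπ i) (M.latchingπ_surjective i) (M.exact_latchingπ i) (RightRep.Hom.app f i) (hf i)
      (u' i) v (fun x l => by
        refine DFunLike.congr_fun (f := AddMonoidHom.comp (u' i x : M.obj i →+ QmodZ.{u})
          (M.latchingMap i).hom.toAddMonoidHom)
          (g := (v (RightRep.Hom.app f i x) : M.latching i →+ QmodZ.{u})) ?_ l
        refine M.latching_addHom_ext fun {h} α hα r m => ?_
        refine Eq.trans ?_ (hv α hα (RightRep.Hom.app f i x) r m).symm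
        change u' i x ((M.latchingMap i).hom _) = _
        rw [latchingMap_toLatching, hbG α hα, ← LinearMap.map_smul (RightRep.Hom.app f i),
          ← RightRep.Hom.naturality f, (ih h (hS α hα)).1, hu', LinearMap.map_smul (u' i),
          HomModule.smul_apply, unop_op])
    refine ⟨w, hw, fun h α hα y m => ?_⟩
    have h1 := hv α hα y 1 m
    rw [op_one, one_smul] at h1
    rw [← hbG α hα, ← h1, ← hw', latchingMap_toLatching, one_smul]
  let g : N' ⟶ M.homRep QmodZ.{u} :=
    { app := G
      naturality := fun {h i} α y => by
        refine HomModule.ext (A := R.obj h) fun m => ?_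
        change G h (N'.map α y) m = G i y (M.map α m)
        by_cases hi : h = i
        · subst hi
          rw [hI.eq_id α, N'.map_id, M.map_id, LinearMap.map_smul (G h), HomModule.smul_apply,
            unop_op]
        · exact (key i).2 h α hi y m }
  exact ⟨g, RightRep.Hom.ext (funext fun i => LinearMap.ext fun x => (key i).1 x)⟩

theorem flatObjects_of_phi (hI : IsDirectCategory I) {M : LeftRep R}
    (hM : Phi R (fun i => flatModules (R.obj i)) M) : flatObjects R M := by
  intro N N' N'' f g h
  refine ⟨?_, M.tensorMap_exact h, M.tensorMap_surjective fun i => (h i).2.2⟩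
  change Function.Injective (M.tensorMap f)
  refine (injective_iff_map_eq_zero _).2 fun x hx => ?_
  by_contra hne
  obtain ⟨c, hc⟩ := QmodZ.exists_apply_ne_zero hne
  obtain ⟨u, hu⟩ := M.exists_homRep_of_tensor c
  obtain ⟨v, rfl⟩ := exists_extension_of_phi hI hM f (fun i => (h i).1) u
  obtain ⟨d, hd⟩ := M.exists_tensor_of_homRep v
  have hdc : d.comp (M.tensorMap f) = c := by
    refine M.tensor_hom_ext fun i n m => ?_
    rw [AddMonoidHom.comp_apply, tensorMap_of, hd, ← hu]
    rfl
  refine hc ?_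
  rw [← hdc, AddMonoidHom.comp_apply, hx, map_zero]

end LeftRep

end

section

/-! ### Inverses of the structural units of a diagram of rings -/

namespace RingDiagram

variable {I : Type u} [SmallCategory I] (R : RingDiagram I)

theorem map_map_mul_tau_inv {i j k : I} (α : i ⟶ j) (β : j ⟶ k) (x : R.obj i) :
    R.map β (R.map α x) * ((R.tau α β)⁻¹ : (R.obj k)ˣ) =
      ((R.tau α β)⁻¹ : (R.obj k)ˣ) * R.map (α ≫ β) x := by
  rw [Units.mul_inv_eq_iff_eq_mul, mul_assoc, ← R.tau_naturality, Units.inv_mul_cancel_left]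

theorem eta_inv_mul_map_id (i : I) (x : R.obj i) :
    ((R.eta i)⁻¹ : (R.obj i)ˣ) * R.map (𝟙 i) x = x * ((R.eta i)⁻¹ : (R.obj i)ˣ) := by
  rw [Units.inv_mul_eq_iff_eq_mul, ← mul_assoc, R.eta_naturality, Units.mul_inv_cancel_right]

theorem map_tau_mul_tau_inv_mul_tau_inv {i j k l : I} (α : i ⟶ j) (β : j ⟶ k) (γ : k ⟶ l) :
    R.map γ (R.tau α β) * ((R.tau β γ)⁻¹ : (R.obj l)ˣ) * ((R.tau α (β ≫ γ))⁻¹ : (R.obj l)ˣ) =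
      ((R.tau (α ≫ β) γ)⁻¹ : (R.obj l)ˣ) := by
  rw [Units.mul_inv_eq_iff_eq_mul, Units.mul_inv_eq_iff_eq_mul, mul_assoc, ← R.assoc,
    Units.inv_mul_cancel_left]

theorem tau_inv_id_left {i j : I} (α : i ⟶ j) :
    (((R.tau (𝟙 i) α)⁻¹ : (R.obj j)ˣ) : R.obj j) = R.map α (R.eta i) :=
  Units.inv_eq_of_mul_eq_one_right (R.id_left α)

theorem eta_inv_mul_tau_inv {i j : I} (α : i ⟶ j) :
    (((R.eta j)⁻¹ : (R.obj j)ˣ) : R.obj j) * ((R.tau α (𝟙 j))⁻¹ : (R.obj j)ˣ) = 1 := by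
  rw [Units.mul_inv_eq_iff_eq_mul, one_mul]
  exact Units.inv_eq_of_mul_eq_one_left (R.id_right α)

end RingDiagram

/-! ### Free right representations and their truncations -/

/-- The restriction of a right `B`-module `X` along a ring homomorphism `A → B`. -/
def RestrictRight {A B : Type u} [Ring A] [Ring B] (_ : A →+* B) (X : Type u) : Type u := X

section RestrictRight

variable {A B : Type u} [Ring A] [Ring B] (f : A →+* B) (X : Type u) [AddCommGroup X]
  [Module Bᵐᵒᵖ X]

instance : AddCommGroup (RestrictRight f X) := inferInstanceAs (AddCommGroup X)

instance : Module Aᵐᵒᵖ (RestrictRight f X) := Module.compHom X f.op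

end RestrictRight

variable {I : Type u} [SmallCategory I] (R : RingDiagram I) (i : I) (Q : I → Prop)

/-- The component at `h` of the free right representation on a right `R_i`-module `X` placed at `i`,
truncated to the objects satisfying `Q`: the direct sum of copies of `X` indexed by the morphisms
`α : h ⟶ i`, on which `R_h` acts through `α`, if `Q h` holds, and zero otherwise. -/
def FreeComponent (X : Type u) [AddCommGroup X] [Module (R.obj i)ᵐᵒᵖ X] (h : I) : Type u :=
  ⨁ α : {_α : h ⟶ i // Q h}, RestrictRight (R.map α.1) X

namespace FreeComponent

variable (X : Type u) [AddCommGroup X] [Module (R.obj i)ᵐᵒᵖ X]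

instance (h : I) : AddCommGroup (FreeComponent R i Q X h) :=
  inferInstanceAs (AddCommGroup (⨁ α : {_α : h ⟶ i // Q h}, RestrictRight (R.map α.1) X))

instance (h : I) : Module (R.obj h)ᵐᵒᵖ (FreeComponent R i Q X h) :=
  inferInstanceAs (Module (R.obj h)ᵐᵒᵖ
    (⨁ α : {_α : h ⟶ i // Q h}, RestrictRight (R.map α.1) X))

variable {R i X}

open Classical in
/-- The inclusion of a summand. -/
def summand {h : I} (α : {_α : h ⟶ i // Q h}) : X →+ FreeComponent R i Q X h :=
  DirectSum.of (fun α : {_α : h ⟶ i // Q h} => RestrictRight (R.map α.1) X) α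

variable (R) in
open Classical in
/-- The inclusion of the copy of `X` at `α : h ⟶ i`; by convention it is zero if `Q h` fails. -/
def of {h : I} (α : h ⟶ i) : X →+ FreeComponent R i Q X h :=
  if hQ : Q h then summand Q ⟨α, hQ⟩ else 0

variable {Q}

theorem eq_zero {h : I} (hQ : ¬ Q h) (s : FreeComponent R i Q X h) : s = 0 := by
  have : IsEmpty {_α : h ⟶ i // Q h} := ⟨fun α => hQ α.2⟩
  exact DFinsupp.ext fun α => isEmptyElim α

theorem of_eq_summand {h : I} (hQ : Q h) (α : h ⟶ i) :
    of R Q α = summand (R := R) (X := X) Q ⟨α, hQ⟩ :=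
  dif_pos hQ

theorem smul_of {h : I} (α : h ⟶ i) (a : R.obj h) (x : X) :
    op a • of R Q α x = of R Q α (op (R.map α a) • x) := by
  by_cases hQ : Q h
  · classical
    rw [of_eq_summand hQ]
    exact (DirectSum.of_smul (M := fun α : {_α : h ⟶ i // Q h} => RestrictRight (R.map α.1) X)
      _ (⟨α, hQ⟩ : {_α : h ⟶ i // Q h}) (op a) x).symm
  · rw [eq_zero hQ (of R Q α (op (R.map α a) • x)), eq_zero hQ (op a • of R Q α x)]

theorem induction_on {h : I} {p : FreeComponent R i Q X h → Prop} (s : FreeComponent R i Q X h)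
    (zero : p 0) (of : Q h → ∀ (α : h ⟶ i) (x : X), p (of R Q α x))
    (add : ∀ s t, p s → p t → p (s + t)) : p s := by
  classical
  refine DirectSum.induction_on s zero (fun α x => ?_) add
  have := of α.2 α.1 x
  rwa [of_eq_summand α.2] at this

theorem addHom_ext {h : I} {G : Type*} [AddCommGroup G] {f g : FreeComponent R i Q X h →+ G}
    (H : Q h → ∀ (α : h ⟶ i) (x : X), f (of R Q α x) = g (of R Q α x)) : f = g := by
  ext s
  induction s using induction_on with
  | zero => simp
  | of hQ α x => exact H hQ α x
  | add s t hs ht => rw [map_add, map_add, hs, ht]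

open Classical in
/-- The additive map out of a direct sum of copies of `X` given by its components. -/
def lift {h : I} {G : Type*} [AddCommGroup G] (b : Q h → (h ⟶ i) → X →+ G) :
    FreeComponent R i Q X h →+ G :=
  DirectSum.toAddMonoid (β := fun α : {_α : h ⟶ i // Q h} => RestrictRight (R.map α.1) X)
    fun α => b α.2 α.1

@[simp]
theorem lift_of {h : I} {G : Type*} [AddCommGroup G] (b : Q h → (h ⟶ i) → X →+ G) (hQ : Q h)
    (α : h ⟶ i) (x : X) : lift b (of R Q α x) = b hQ α x := by
  classical
  rw [of_eq_summand hQ]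
  exact DirectSum.toAddMonoid_of
    (β := fun α : {_α : h ⟶ i // Q h} => RestrictRight (R.map α.1) X) _ ⟨α, hQ⟩ x

theorem of_injective {h : I} (hQ : Q h) (α : h ⟶ i) :
    Function.Injective (of (X := X) R Q α) := fun x y hxy => by
  classical
  rw [of_eq_summand hQ] at hxy
  exact DirectSum.of_injective
    (β := fun α : {_α : h ⟶ i // Q h} => RestrictRight (R.map α.1) X) ⟨α, hQ⟩ hxy

/-- The structural map at `γ : h ⟶ k`, which sends the copy of `X` at `δ : k ⟶ i` to the copy at
`γ ≫ δ`.  The twist by the inverse of `τ` reflects that the element `x` at `δ` stands for `N_δ(x)`,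
where `N_γ(N_δ(x τ)) = N_{γ ≫ δ}(x)` in a right representation `N`. -/
def res {h k : I} (γ : h ⟶ k) : FreeComponent R i Q X k →+ FreeComponent R i Q X h :=
  lift fun _ δ => (of R Q (γ ≫ δ)).comp
    (DistribSMul.toAddMonoidHom X (op (((R.tau γ δ)⁻¹ : (R.obj i)ˣ) : R.obj i)))

theorem res_of {h k : I} (γ : h ⟶ k) (hQ : Q k) (δ : k ⟶ i) (x : X) :
    res γ (of R Q δ x) =
      of R Q (γ ≫ δ) (op (((R.tau γ δ)⁻¹ : (R.obj i)ˣ) : R.obj i) • x) :=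
  lift_of _ hQ δ x

end FreeComponent

section FreeRep

variable {i Q}

/-- The condition under which truncating a free right representation at `i` to the objects
satisfying `Q` yields a right representation, that is, a subquotient. -/
def IsConvexOver (i : I) (Q : I → Prop) : Prop :=
  ∀ ⦃h k l : I⦄, (h ⟶ k) → (k ⟶ l) → (l ⟶ i) → Q h → Q l → Q k

/-- The free right representation on a right `R_i`-module `X` placed at `i`, truncated to the
objects satisfying `Q`. -/
abbrev freeRep (hQ : IsConvexOver i Q) (X : Type u) [AddCommGroup X] [Module (R.obj i)ᵐᵒᵖ X] :
    RightRep R where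
  obj h := ModuleCat.of _ (FreeComponent R i Q X h)
  map γ := FreeComponent.res γ
  map_smul {h k} γ a s := by
    change FreeComponent.res γ (op (R.map γ a) • s) = op a • FreeComponent.res γ s
    induction s using FreeComponent.induction_on with
    | zero => simp
    | of hk δ x =>
      rw [FreeComponent.smul_of, FreeComponent.res_of γ hk, FreeComponent.res_of γ hk,
        FreeComponent.smul_of, smul_smul, smul_smul, ← op_mul, ← op_mul, R.map_map_mul_tau_inv]
    | add s t hs ht => rw [smul_add, map_add, map_add, smul_add, hs, ht]
  map_id h s := by
    change FreeComponent.res (𝟙 h) s = op (R.eta h : R.obj h) • s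
    induction s using FreeComponent.induction_on with
    | zero => simp
    | of hh δ x =>
      rw [FreeComponent.smul_of, FreeComponent.res_of _ hh, Category.id_comp,
        R.tau_inv_id_left]
    | add s t hs ht => rw [smul_add, map_add, hs, ht]
  map_comp {h j k} α β s := by
    change FreeComponent.res (α ≫ β) s =
      FreeComponent.res α (FreeComponent.res β (op (R.tau α β : R.obj k) • s))
    by_cases hh : Q h
    · induction s using FreeComponent.induction_on with
      | zero => simp
      | of hk δ x =>
        rw [FreeComponent.smul_of, FreeComponent.res_of _ hk, FreeComponent.res_of _ hk,
          FreeComponent.res_of _ (hQ α β δ hh hk), Category.assoc, smul_smul, smul_smul, ← op_mul,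
          ← op_mul, ← mul_assoc, R.map_tau_mul_tau_inv_mul_tau_inv]
      | add s t hs ht => rw [smul_add, map_add, map_add, map_add, hs, ht]
    · rw [FreeComponent.eq_zero hh (FreeComponent.res (α ≫ β) s),
        FreeComponent.eq_zero hh (FreeComponent.res α _)]

variable {R}

/-- The generators of a free right representation, scaled by `η⁻¹` so as to be `R_i`-linear. -/
def freeRepUnit (Q : I → Prop) (X : Type u) [AddCommGroup X] [Module (R.obj i)ᵐᵒᵖ X] :
    X →ₗ[(R.obj i)ᵐᵒᵖ] FreeComponent R i Q X i where
  toFun x := FreeComponent.of R Q (𝟙 i) (op (((R.eta i)⁻¹ : (R.obj i)ˣ) : R.obj i) • x)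
  map_add' x y := by rw [smul_add, map_add]
  map_smul' a x := by
    obtain ⟨a, rfl⟩ := op_surjective a
    rw [RingHom.id_apply, FreeComponent.smul_of, smul_smul, smul_smul, ← op_mul, ← op_mul,
      R.eta_inv_mul_map_id]

theorem res_freeRepUnit {X : Type u} [AddCommGroup X] [Module (R.obj i)ᵐᵒᵖ X] (hi : Q i) {h : I}
    (α : h ⟶ i) (x : X) :
    FreeComponent.res α (freeRepUnit Q X x) = FreeComponent.of R Q α x := by
  change FreeComponent.res α (FreeComponent.of R Q (𝟙 i) _) = _
  rw [FreeComponent.res_of _ hi, Category.comp_id, smul_smul, ← op_mul,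
    R.eta_inv_mul_tau_inv, op_one, one_smul]

variable {Q' Q'' : I → Prop} {X Y Z : Type u} [AddCommGroup X] [Module (R.obj i)ᵐᵒᵖ X]
  [AddCommGroup Y] [Module (R.obj i)ᵐᵒᵖ Y] [AddCommGroup Z] [Module (R.obj i)ᵐᵒᵖ Z]

/-- The map of components induced by `f : X → Y` on the copies that are present on both sides, and
zero on the remaining ones. -/
def FreeComponent.map (Q Q' : I → Prop) (f : X →ₗ[(R.obj i)ᵐᵒᵖ] Y) (h : I) :
    FreeComponent R i Q X h →ₗ[(R.obj h)ᵐᵒᵖ] FreeComponent R i Q' Y h :=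
  { FreeComponent.lift (Q := Q) fun _ α =>
      (FreeComponent.of R Q' α).comp f.toAddMonoidHom with
    map_smul' := fun a s => by
      obtain ⟨a, rfl⟩ := op_surjective a
      change FreeComponent.lift _ _ = op a • FreeComponent.lift _ _
      induction s using FreeComponent.induction_on with
      | zero => simp
      | of hh α x =>
        rw [FreeComponent.smul_of, FreeComponent.lift_of _ hh, FreeComponent.lift_of _ hh]
        change FreeComponent.of R Q' α (f _) = op a • FreeComponent.of R Q' α (f x)
        rw [map_smul, FreeComponent.smul_of]
      | add s t hs ht => rw [smul_add, map_add, map_add, smul_add, hs, ht] }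

theorem FreeComponent.map_of (f : X →ₗ[(R.obj i)ᵐᵒᵖ] Y) {h : I} (hh : Q h) (α : h ⟶ i) (x : X) :
    FreeComponent.map Q Q' f h (FreeComponent.of R Q α x) = FreeComponent.of R Q' α (f x) :=
  FreeComponent.lift_of (fun _ α => (FreeComponent.of R Q' α).comp f.toAddMonoidHom) hh α x

theorem FreeComponent.map_id {h : I} (s : FreeComponent R i Q X h) :
    FreeComponent.map Q Q LinearMap.id h s = s := by
  induction s using FreeComponent.induction_on with
  | zero => simp
  | of hh α x => exact FreeComponent.map_of _ hh α x
  | add s t hs ht => rw [map_add, hs, ht]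

theorem FreeComponent.map_map (f : X →ₗ[(R.obj i)ᵐᵒᵖ] Y) (g : Y →ₗ[(R.obj i)ᵐᵒᵖ] Z) {h : I}
    (hh : Q' h) (s : FreeComponent R i Q X h) :
    FreeComponent.map Q' Q'' g h (FreeComponent.map Q Q' f h s) =
      FreeComponent.map Q Q'' (g.comp f) h s := by
  induction s using FreeComponent.induction_on with
  | zero => simp
  | of hh' α x =>
    rw [FreeComponent.map_of _ hh', FreeComponent.map_of _ hh, FreeComponent.map_of _ hh']; rfl
  | add s t hs ht => rw [map_add, map_add, map_add, hs, ht]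

/-- The morphism between truncated free right representations induced by `f : X → Y`. -/
def freeRepMap (hQ : IsConvexOver i Q) (hQ' : IsConvexOver i Q')
    (hQQ' : ∀ ⦃h k : I⦄, (h ⟶ k) → (k ⟶ i) → Q k → Q' h → (Q h ↔ Q' k))
    (f : X →ₗ[(R.obj i)ᵐᵒᵖ] Y) : freeRep R hQ X ⟶ freeRep R hQ' Y where
  app h := FreeComponent.map Q Q' f h
  naturality {h k} γ s := by
    change FreeComponent.map Q Q' f h (FreeComponent.res γ s) =
      FreeComponent.res γ (FreeComponent.map Q Q' f k s)
    by_cases hh : Q' h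
    · induction s using FreeComponent.induction_on with
      | zero => simp
      | of hk δ x =>
        rw [FreeComponent.res_of _ hk, FreeComponent.map_of _ hk]
        by_cases hh' : Q h
        · rw [FreeComponent.map_of _ hh', FreeComponent.res_of _ ((hQQ' γ δ hk hh).1 hh'), map_smul]
        · rw [FreeComponent.eq_zero hh' (FreeComponent.of R Q _ _),
            FreeComponent.eq_zero (mt (hQQ' γ δ hk hh).2 hh') (FreeComponent.of R Q' δ _), map_zero,
            map_zero]
      | add s t hs ht => rw [map_add, map_add, map_add, map_add, hs, ht]
    · rw [FreeComponent.eq_zero hh (FreeComponent.map Q Q' f h _),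
        FreeComponent.eq_zero hh (FreeComponent.res γ _)]

end FreeRep

end

section

variable {I : Type u} [SmallCategory I] {R : RingDiagram I} {i : I} {Q : I → Prop}

/-! ### The tensor product with a truncated free right representation -/

namespace LeftRep

variable (M : LeftRep R) {X G : Type u} [AddCommGroup X] [Module (R.obj i)ᵐᵒᵖ X] [AddCommGroup G]

/-- The element of `M ⊗_R N` for `N` the truncated free right representation on `X`, given by `x` in
the copy of `X` at `α : h ⟶ i` and by `m ∈ M_h`. -/
def freeTmul (hQ : IsConvexOver i Q) {h : I} (α : h ⟶ i) (x : X) (m : M.obj h) :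
    M.tensor (freeRep R hQ X) :=
  M.tensorOf (freeRep R hQ X) h (RingTensor.tmul (R.obj h) (FreeComponent.of R Q α x) m)

theorem freeTmul_eq_zero (hQ : IsConvexOver i Q) {h : I} (hh : ¬ Q h) (α : h ⟶ i) (x : X)
    (m : M.obj h) : M.freeTmul hQ α x m = 0 := by
  unfold freeTmul
  rw [FreeComponent.eq_zero hh (FreeComponent.of R Q α x)]
  exact (congrArg _ (DFunLike.congr_fun (map_zero (RingTensor.mk (R.obj h))) m)).trans (map_zero _)

/-- The biadditive map `(x, m) ↦ M.freeTmul hQ α x m`. -/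
def freeMk (hQ : IsConvexOver i Q) {h : I} (α : h ⟶ i) :
    X →+ M.obj h →+ M.tensor (freeRep R hQ X) :=
  (AddMonoidHom.compHom (M.tensorOf (freeRep R hQ X) h)).comp
    ((RingTensor.mk (R.obj h) (N := (freeRep R hQ X).obj h)).comp (FreeComponent.of R Q α))

theorem freeMk_apply (hQ : IsConvexOver i Q) {h : I} (α : h ⟶ i) (x : X) (m : M.obj h) :
    M.freeMk hQ α x m = M.freeTmul hQ α x m := rfl

theorem freeTmul_smul (hQ : IsConvexOver i Q) {h : I} (α : h ⟶ i) (x : X) (a : R.obj h)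
    (m : M.obj h) :
    M.freeTmul hQ α (op (R.map α a) • x) m = M.freeTmul hQ α x (a • m) := by
  unfold freeTmul
  rw [← FreeComponent.smul_of]
  exact congrArg _ (RingTensor.smul_tmul (R.obj h) (N := (freeRep R hQ X).obj h) _ a m)

theorem freeTmul_comp (hQ : IsConvexOver i Q) {h k : I} (hk : Q k) (γ : h ⟶ k) (δ : k ⟶ i) (x : X)
    (m : M.obj h) :
    M.freeTmul hQ δ (op (R.tau γ δ : R.obj i) • x) (M.map γ m) =
      M.freeTmul hQ (γ ≫ δ) x m := by
  refine (M.tensorOf_balanced (N := freeRep R hQ X) γ _ m).symm.trans ?_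
  change M.tensorOf (freeRep R hQ X) h (RingTensor.tmul (R.obj h) (FreeComponent.res γ _) m) = _
  rw [FreeComponent.res_of γ hk, smul_smul, ← op_mul, Units.mul_inv, op_one, one_smul]
  rfl

theorem freeTmul_hom_ext (hQ : IsConvexOver i Q) {f g : M.tensor (freeRep R hQ X) →+ G}
    (H : ∀ {h : I} (_ : Q h) (α : h ⟶ i) (x : X) (m : M.obj h),
      f (M.freeTmul hQ α x m) = g (M.freeTmul hQ α x m)) : f = g := by
  refine M.tensor_hom_ext fun h s m => ?_
  let t : FreeComponent R i Q X h →+ M.tensor (freeRep R hQ X) :=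
    (M.tensorOf (freeRep R hQ X) h).comp ((RingTensor.mk (R.obj h)).flip m)
  exact DFunLike.congr_fun (f := f.comp t) (g := g.comp t)
    (FreeComponent.addHom_ext fun hh α x => H hh α x m) s

/-- Additive maps out of the tensor product with a truncated free right representation. -/
theorem exists_freeTmul_lift (hQ : IsConvexOver i Q)
    (b : ∀ {h : I} (_ : Q h) (_ : h ⟶ i), X →+ M.obj h →+ G)
    (hb : ∀ {h : I} (hh : Q h) (α : h ⟶ i) (x : X) (a : R.obj h) (m : M.obj h),
      b hh α (op (R.map α a) • x) m = b hh α x (a • m))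
    (hb_map : ∀ {h k : I} (hh : Q h) (hk : Q k) (γ : h ⟶ k) (δ : k ⟶ i) (x : X) (m : M.obj h),
      b hh (γ ≫ δ) x m = b hk δ (op (R.tau γ δ : R.obj i) • x) (M.map γ m))
    (hb_zero : ∀ {h k : I} (_ : ¬ Q h) (hk : Q k) (γ : h ⟶ k) (δ : k ⟶ i) (x : X) (m : M.obj h),
      b hk δ x (M.map γ m) = 0) :
    ∃ t : M.tensor (freeRep R hQ X) →+ G, ∀ {h : I} (hh : Q h) (α : h ⟶ i) (x : X) (m : M.obj h),
      t (M.freeTmul hQ α x m) = b hh α x m := by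
  let c (h : I) : FreeComponent R i Q X h →+ M.obj h →+ G :=
    FreeComponent.lift fun hh α => b hh α
  have hc : ∀ {h : I} (hh : Q h) (α : h ⟶ i) (x : X),
      c h (FreeComponent.of R Q α x) = b hh α x := fun hh α x => FreeComponent.lift_of _ hh α x
  refine ⟨M.tensorLift (N := freeRep R hQ X)
    (fun h => RingTensor.lift (R.obj h) (c h) fun s a m => ?_) fun h k γ s m => ?_,
    fun {h} hh α x m => ?_⟩
  · induction s using FreeComponent.induction_on with
    | zero => simp
    | of hh α x => rw [FreeComponent.smul_of, hc hh, hc hh, hb]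
    | add s t hs ht =>
      rw [smul_add, map_add, map_add, AddMonoidHom.add_apply, AddMonoidHom.add_apply, hs, ht]
  · change c h (FreeComponent.res γ s) m = c k s (M.map γ m)
    induction s using FreeComponent.induction_on with
    | zero => simp
    | of hk δ x =>
      by_cases hh : Q h
      · rw [FreeComponent.res_of _ hk, hc hh, hc hk, hb_map hh hk, smul_smul, ← op_mul,
          Units.inv_mul, op_one, one_smul]
      · rw [hc hk, hb_zero hh hk, FreeComponent.eq_zero hh (FreeComponent.res γ _), map_zero,
          AddMonoidHom.zero_apply]
    | add s t hs ht =>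
      rw [map_add, map_add, map_add, AddMonoidHom.add_apply, AddMonoidHom.add_apply, hs, ht]
  · refine (M.tensorLift_of _ _ h _).trans ?_
    rw [RingTensor.lift_tmul, hc hh]

theorem tensorMap_freeTmul {Q' : I → Prop} {Y : Type u} [AddCommGroup Y] [Module (R.obj i)ᵐᵒᵖ Y]
    (hQ : IsConvexOver i Q) (hQ' : IsConvexOver i Q')
    (hQQ' : ∀ ⦃h k : I⦄, (h ⟶ k) → (k ⟶ i) → Q k → Q' h → (Q h ↔ Q' k))
    (f : X →ₗ[(R.obj i)ᵐᵒᵖ] Y) {h : I} (hh : Q h) (α : h ⟶ i) (x : X) (m : M.obj h) :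
    M.tensorMap (freeRepMap hQ hQ' hQQ' f) (M.freeTmul hQ α x m) = M.freeTmul hQ' α (f x) m := by
  refine (M.tensorMap_of (freeRepMap hQ hQ' hQQ' f) h (FreeComponent.of R Q α x) m).trans ?_
  exact congrArg (fun s => M.tensorOf (freeRep R hQ' Y) h (RingTensor.tmul (R.obj h) s m))
    (FreeComponent.map_of f hh α x)

/-- The balanced map `X × M_i → M ⊗_R N`, for `N` the truncated free right representation on `X`,
given by the unit `X → N_i`.  For `Q = ⊤` it exhibits `M ⊗_R N` as `X ⊗_{R_i} M_i`. -/
def freeUnitTmul (hQ : IsConvexOver i Q) (X : Type u) [AddCommGroup X] [Module (R.obj i)ᵐᵒᵖ X] :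
    X →ₗ[(R.obj i)ᵐᵒᵖ] HomModule (R.obj i) (M.obj i) (M.tensor (freeRep R hQ X)) where
  toFun x := (M.tensorOf (freeRep R hQ X) i).comp
    (RingTensor.mk (R.obj i) (N := (freeRep R hQ X).obj i) (freeRepUnit Q X x))
  map_add' x y := HomModule.ext (A := R.obj i) fun m => by
    change M.tensorOf (freeRep R hQ X) i (RingTensor.mk (R.obj i) (freeRepUnit Q X (x + y)) m) =
      M.tensorOf (freeRep R hQ X) i (RingTensor.mk (R.obj i) (freeRepUnit Q X x) m) +
      M.tensorOf (freeRep R hQ X) i (RingTensor.mk (R.obj i) (freeRepUnit Q X y) m)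
    rw [map_add, map_add, AddMonoidHom.add_apply, map_add]
  map_smul' a x := HomModule.ext (A := R.obj i) fun m => by
    change M.tensorOf (freeRep R hQ X) i
        (RingTensor.tmul (R.obj i) (freeRepUnit Q X (op a.unop • x)) m) =
      M.tensorOf (freeRep R hQ X) i
        (RingTensor.tmul (R.obj i) (freeRepUnit Q X x) (a.unop • m))
    rw [map_smul, RingTensor.smul_tmul]

theorem freeUnitTmul_map (hQ : IsConvexOver i Q) (hi : Q i) {h : I} (α : h ⟶ i) (x : X)
    (m : M.obj h) : M.freeUnitTmul hQ X x (M.map α m) = M.freeTmul hQ α x m := by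
  refine (M.tensorOf_balanced (N := freeRep R hQ X) α (freeRepUnit Q X x) m).symm.trans ?_
  exact congrArg (fun s => M.tensorOf (freeRep R hQ X) h (RingTensor.tmul (R.obj h) s m))
    (res_freeRepUnit hi α x)

end LeftRep

/-! ### The latching condition for flat representations -/

theorem isConvexOver_true (i : I) : IsConvexOver i fun _ => True := fun _ _ _ _ _ _ _ _ => trivial

theorem IsDirectCategory.isConvexOver_ne (hI : IsDirectCategory I) (i : I) :
    IsConvexOver i (· ≠ i) := by
  rintro h k l - β δ - hl rfl
  exact hl (hI.eq_of_hom_of_hom δ β)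

theorem IsDirectCategory.isConvexOver_eq (hI : IsDirectCategory I) (i : I) :
    IsConvexOver i (· = i) := by
  rintro h k l α β - rfl rfl
  exact hI.eq_of_hom_of_hom β α

theorem IsDirectCategory.of_id_surjective (hI : IsDirectCategory I) {X : Type u} [AddCommGroup X]
    [Module (R.obj i)ᵐᵒᵖ X] :
    Function.Surjective (FreeComponent.of (X := X) R (· = i) (𝟙 i)) := fun s => by
  induction s using FreeComponent.induction_on with
  | zero => exact ⟨0, map_zero _⟩
  | of _ α x => exact ⟨x, by rw [hI.eq_id α]⟩
  | add s t hs ht =>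
    obtain ⟨x, rfl⟩ := hs
    obtain ⟨y, rfl⟩ := ht
    exact ⟨x + y, map_add _ _ _⟩

theorem IsShortExact.of_addEquiv {X Y Z X' Y' Z' : Type u} [AddCommGroup X] [AddCommGroup Y]
    [AddCommGroup Z] [AddCommGroup X'] [AddCommGroup Y'] [AddCommGroup Z'] {f : X →+ Y} {g : Y →+ Z}
    {f' : X' →+ Y'} {g' : Y' →+ Z'} (h : IsShortExact f g) (eX : X ≃+ X') (eY : Y ≃+ Y')
    (eZ : Z ≃+ Z') (hf : ∀ x, f' (eX x) = eY (f x)) (hg : ∀ y, g' (eY y) = eZ (g y)) :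
    IsShortExact f' g' := by
  obtain ⟨h1, h2, h3⟩ := h
  refine ⟨fun x x' hx => ?_, fun y => ?_, fun z => ?_⟩
  · obtain ⟨x, rfl⟩ := eX.surjective x
    obtain ⟨x', rfl⟩ := eX.surjective x'
    rw [hf, hf] at hx
    rw [h1 (eY.injective hx)]
  · obtain ⟨y, rfl⟩ := eY.surjective y
    rw [hg, eZ.map_eq_zero_iff, h2 y]
    constructor
    · rintro ⟨x, rfl⟩
      exact ⟨eX x, hf x⟩
    · rintro ⟨x, hx⟩
      obtain ⟨x, rfl⟩ := eX.surjective x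
      exact ⟨x, eY.injective ((hf x).symm.trans hx)⟩
  · obtain ⟨z, rfl⟩ := eZ.surjective z
    obtain ⟨y, rfl⟩ := h3 z
    exact ⟨eY y, hg y⟩

/-- The morphism induced by `f : X → Y` between the right representations that are `X` and `Y` at
`i` and zero elsewhere. -/
def stalkMap (hI : IsDirectCategory I) {X Y : Type u} [AddCommGroup X] [Module (R.obj i)ᵐᵒᵖ X]
    [AddCommGroup Y] [Module (R.obj i)ᵐᵒᵖ Y] (f : X →ₗ[(R.obj i)ᵐᵒᵖ] Y) :
    freeRep R (hI.isConvexOver_eq i) X ⟶ freeRep R (hI.isConvexOver_eq i) Y :=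
  freeRepMap _ _ (fun _ _ _ _ hk hh => iff_of_true hh hk) f

theorem shortExact_stalkMap (hI : IsDirectCategory I) {X Y Z : Type u} [AddCommGroup X]
    [Module (R.obj i)ᵐᵒᵖ X] [AddCommGroup Y] [Module (R.obj i)ᵐᵒᵖ Y] [AddCommGroup Z]
    [Module (R.obj i)ᵐᵒᵖ Z] (f : X →ₗ[(R.obj i)ᵐᵒᵖ] Y) (g : Y →ₗ[(R.obj i)ᵐᵒᵖ] Z)
    (h : IsShortExact f.toAddMonoidHom g.toAddMonoidHom) :
    RightRep.ShortExact (stalkMap hI f) (stalkMap hI g) := by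
  intro k
  change IsShortExact (FreeComponent.map (· = i) (· = i) f k).toAddMonoidHom
    (FreeComponent.map (· = i) (· = i) g k).toAddMonoidHom
  by_cases hk : k = i
  · subst hk
    let e (X : Type u) [AddCommGroup X] [Module (R.obj k)ᵐᵒᵖ X] :
        X ≃+ FreeComponent R k (· = k) X k :=
      AddEquiv.ofBijective (FreeComponent.of R (· = k) (𝟙 k))
        ⟨FreeComponent.of_injective rfl _, hI.of_id_surjective⟩
    exact h.of_addEquiv (e X) (e Y) (e Z) (fun x => FreeComponent.map_of (Q := (· = k)) f rfl _ x)
      (fun y => FreeComponent.map_of (Q := (· = k)) g rfl _ y)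
  · have h0 {W : Type u} [AddCommGroup W] [Module (R.obj i)ᵐᵒᵖ W]
        (s : FreeComponent R i (· = i) W k) : s = 0 :=
      FreeComponent.eq_zero (Q := (· = i)) hk s
    exact ⟨fun s t _ => (h0 s).trans (h0 t).symm,
      fun s => iff_of_true (h0 _) ⟨0, (map_zero _).trans (h0 s).symm⟩,
      fun s => ⟨0, (map_zero _).trans (h0 s).symm⟩⟩

/-- The inclusion of the part away from `i` into the free right representation on `X`. -/
def freeRepIncl (hI : IsDirectCategory I) (X : Type u) [AddCommGroup X] [Module (R.obj i)ᵐᵒᵖ X] :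
    freeRep R (hI.isConvexOver_ne i) X ⟶ freeRep R (isConvexOver_true i) X :=
  freeRepMap _ _ (fun _ _ γ δ hk _ => iff_of_true (fun hh => hk <| by
    subst hh; exact hI.eq_of_hom_of_hom δ γ) trivial) LinearMap.id

/-- The projection of the free right representation on `X` onto its part at `i`. -/
def freeRepProj (hI : IsDirectCategory I) (X : Type u) [AddCommGroup X] [Module (R.obj i)ᵐᵒᵖ X] :
    freeRep R (isConvexOver_true i) X ⟶ freeRep R (hI.isConvexOver_eq i) X :=
  freeRepMap _ _ (fun _ _ γ δ _ hh => iff_of_true trivial <| by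
    subst hh; exact hI.eq_of_hom_of_hom δ γ) LinearMap.id

theorem shortExact_freeRepIncl_freeRepProj (hI : IsDirectCategory I) (X : Type u) [AddCommGroup X]
    [Module (R.obj i)ᵐᵒᵖ X] :
    RightRep.ShortExact (freeRepIncl (R := R) (i := i) hI X) (freeRepProj hI X) := by
  intro h
  have hid {Q Q' : I → Prop} (hQQ' : Q h → Q' h) : Function.LeftInverse
      (FreeComponent.map (R := R) (X := X) (i := i) Q' Q LinearMap.id h)
      (FreeComponent.map Q Q' LinearMap.id h) := fun s => by
    by_cases hh : Q h
    · rw [FreeComponent.map_map _ _ (hQQ' hh)]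
      exact FreeComponent.map_id s
    · rw [FreeComponent.eq_zero hh (FreeComponent.map _ _ _ _ _), FreeComponent.eq_zero hh s]
  refine ⟨(hid (Q := (· ≠ i)) (Q' := fun _ => True) fun _ => trivial).injective, fun s => ?_,
    (hid (Q := (· = i)) (Q' := fun _ => True) fun _ => trivial).surjective⟩
  change FreeComponent R i (fun _ => True) X h at s
  change FreeComponent.map _ (· = i) LinearMap.id h s = 0 ↔
    s ∈ Set.range (FreeComponent.map (X := X) (· ≠ i) (fun _ => True) LinearMap.id h)
  by_cases hh : h = i
  · constructor
    · intro hs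
      have := hid (Q := fun _ => True) (Q' := (· = i)) (fun _ => hh) s
      rw [hs, map_zero] at this
      exact ⟨0, by rw [map_zero, this]⟩
    · rintro ⟨t, rfl⟩
      rw [FreeComponent.eq_zero (Q := (· ≠ i)) (not_not.2 hh) t, map_zero, map_zero]
  · refine iff_of_true (FreeComponent.eq_zero (Q := (· = i)) hh _)
      ⟨FreeComponent.map _ _ LinearMap.id h s, ?_⟩
    exact hid (Q := fun _ => True) (Q' := (· ≠ i)) (fun _ => hh) s

namespace LeftRep

variable (M : LeftRep R)

/-- The comparison of the latching module with the tensor product of `M` and the part away from `i`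
of the free right representation on `R_i`. -/
theorem exists_freeTmul_of_latching (hQ : IsConvexOver i (· ≠ i)) :
    ∃ a : M.latching i →+ M.tensor (freeRep R hQ (R.obj i)),
      ∀ {h : I} (α : h ⟶ i) (hα : h ≠ i) (r : R.obj i) (m : M.obj h),
        a (M.toLatching α hα (BaseChange.tmul _ r m)) = M.freeTmul hQ α r m := by
  obtain ⟨a, ha⟩ := M.exists_latching_lift (X := R.obj i) (fun α _ => M.freeMk hQ α)
    (fun α _ x a m => M.freeTmul_smul hQ α x a m)
    (fun γ δ _ hδ x m => M.freeTmul_comp hQ hδ γ δ x m)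
  refine ⟨a 1, fun α hα r m => (ha α hα 1 r m).trans ?_⟩
  rw [freeMk_apply, op_smul_eq_mul, one_mul]

theorem toLatching_tmul {h : I} (α : h ⟶ i) (hα : h ≠ i) (r : R.obj i) (m : M.obj h) :
    M.toLatching α hα (BaseChange.tmul _ r m) =
      r • M.toLatching α hα (BaseChange.tmul _ 1 m) := by
  rw [← map_smul, BaseChange.smul_tmul, mul_one]

theorem exists_latching_of_freeTmul (hI : IsDirectCategory I) :
    ∃ b : M.tensor (freeRep R (hI.isConvexOver_ne i) (R.obj i)) →+ M.latching i,
      ∀ {h : I} (α : h ⟶ i) (hα : h ≠ i) (r : R.obj i) (m : M.obj h),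
        b (M.freeTmul (hI.isConvexOver_ne i) α r m) =
          M.toLatching α hα (BaseChange.tmul _ r m) := by
  obtain ⟨b, hb⟩ := M.exists_freeTmul_lift (X := R.obj i) (G := M.latching i)
    (hI.isConvexOver_ne i)
    (fun hα α => (smulAddHom (R.obj i) (M.latching i)).compl₂
      ((BaseChange.liftEquiv _).symm (M.toLatching α hα)).toAddMonoidHom)
    (fun {h} hα α x a m => by
      change (op (R.map α a) • x) • M.toLatching α hα (BaseChange.tmul _ 1 m) =
        x • M.toLatching α hα (BaseChange.tmul _ 1 (a • m))
      rw [BaseChange.tmul_smul, one_mul, op_smul_eq_mul, mul_smul, ← toLatching_tmul])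
    (fun {h k} hh hk γ δ x m => by
      change x • M.toLatching (γ ≫ δ) hh (BaseChange.tmul _ 1 m) =
        (op (R.tau γ δ : R.obj i) • x) • M.toLatching δ hk (BaseChange.tmul _ 1 (M.map γ m))
      rw [op_smul_eq_mul, mul_smul, ← toLatching_tmul M δ, toLatching_comp M γ δ hh hk, one_mul])
    (fun {h k} hh hk γ δ x m => by
      obtain rfl := not_not.1 hh
      exact absurd (hI.eq_of_hom_of_hom δ γ) hk)
  exact ⟨b, fun α hα r m => (hb hα α r m).trans (M.toLatching_tmul α hα r m).symm⟩

variable {M}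

theorem mono_latchingMap_of_flat (hI : IsDirectCategory I) (hM : flatObjects R M) (i : I) :
    Mono (M.latchingMap i) := by
  have hQ := hI.isConvexOver_ne i
  have hinj : Function.Injective (M.tensorMap (freeRepIncl (R := R) (i := i) hI (R.obj i))) :=
    (hM _ _ _ _ _ (shortExact_freeRepIncl_freeRepProj hI (R.obj i))).1
  obtain ⟨a, ha⟩ := M.exists_freeTmul_of_latching (i := i) hQ
  obtain ⟨b, hb⟩ := M.exists_latching_of_freeTmul (i := i) hI
  have hba : b.comp a = AddMonoidHom.id _ :=
    M.latching_addHom_ext fun α hα r m => (congrArg b (ha α hα r m)).trans (hb α hα r m)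
  let d : M.obj i →+ M.tensor (freeRep R (isConvexOver_true i) (R.obj i)) :=
    M.freeUnitTmul (isConvexOver_true i) (R.obj i) 1
  have hd : ∀ (r : R.obj i) (m : M.obj i), d (r • m) =
      M.freeUnitTmul (isConvexOver_true i) (R.obj i) r m := fun r m => by
    refine (HomModule.smul_apply (op r)
      (M.freeUnitTmul (isConvexOver_true i) (R.obj i) 1) m).symm.trans ?_
    rw [← map_smul, op_smul_eq_mul, one_mul]
  -- The square relating `φ_i` to the map of tensor products induced by the inclusion commutes.
  have hfa : (M.tensorMap (freeRepIncl (R := R) (i := i) hI (R.obj i))).comp a =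
      d.comp (M.latchingMap i).hom.toAddMonoidHom :=
    M.latching_addHom_ext fun {h} α hα r m => by
      refine (congrArg (M.tensorMap _) (ha α hα r m)).trans ?_
      refine (M.tensorMap_freeTmul (Q := (· ≠ i)) _ _ _ _ hα α r m).trans ?_
      change _ = d ((M.latchingMap i).hom _)
      rw [latchingMap_toLatching, hd, freeUnitTmul_map _ _ trivial]
      rfl
  refine (ModuleCat.mono_iff_injective _).2
    ((injective_iff_map_eq_zero (M.latchingMap i).hom).2 fun l hl => ?_)
  have hal : a l = 0 := hinj <| by
    refine (DFunLike.congr_fun hfa l).trans ?_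
    rw [map_zero]
    exact (congrArg d hl).trans (map_zero d)
  refine (DFunLike.congr_fun hba l).symm.trans ?_
  exact (congrArg b hal).trans (map_zero b)

/-- The tensor product of `M` with the right representation that is `X` at `i` and zero elsewhere is
the tensor product of `X` with the cokernel of the latching map. -/
theorem exists_tensor_stalk_equiv (hI : IsDirectCategory I) (M : LeftRep R) (i : I)
    (X : Type u) [AddCommGroup X] [Module (R.obj i)ᵐᵒᵖ X] :
    ∃ e : M.tensor (freeRep R (hI.isConvexOver_eq i) X) ≃+
        RingTensor (R.obj i) X (cokernel (M.latchingMap i) : ModuleCat (R.obj i)),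
      ∀ {h : I} (_ : h = i) (α : h ⟶ i) (x : X) (m : M.obj h),
        e (M.freeTmul (hI.isConvexOver_eq i) α x m) =
          RingTensor.tmul (R.obj i) x (M.latchingπ i (M.map α m)) := by
  have hQ := hI.isConvexOver_eq i
  have hvanish : ∀ (x : X) (p : M.obj i), M.latchingπ i p = 0 → M.freeUnitTmul hQ X x p = 0 := by
    intro x p hp
    obtain ⟨l, rfl⟩ := (M.exact_latchingπ i p).1 hp
    refine DFunLike.congr_fun (f := AddMonoidHom.comp (M.freeUnitTmul hQ X x : M.obj i →+ _)
      (M.latchingMap i).hom.toAddMonoidHom) (g := 0)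
      (M.latching_addHom_ext fun α hα r m => ?_) l
    change M.freeUnitTmul hQ X x ((M.latchingMap i).hom _) = 0
    rw [latchingMap_toLatching]
    refine (HomModule.smul_apply (op r) (M.freeUnitTmul hQ X x) (M.map α m)).symm.trans ?_
    rw [← map_smul, M.freeUnitTmul_map hQ rfl, M.freeTmul_eq_zero hQ hα]
  obtain ⟨k, hk⟩ := RingTensor.exists_descend (M.latchingπ i) (M.latchingπ_surjective i)
    (M.freeUnitTmul hQ X) hvanish
  obtain ⟨e, he⟩ := M.exists_freeTmul_lift (X := X)
    (G := RingTensor (R.obj i) X (cokernel (M.latchingMap i) : ModuleCat (R.obj i))) hQ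
    (fun _ α => (RingTensor.mk (R.obj i)).compl₂
      ((M.latchingπ i).toAddMonoidHom.comp (M.map α).toAddMonoidHom))
    (fun {h} _ α x a m => by
      change RingTensor.tmul _ (op (R.map α a) • x) (M.latchingπ i (M.map α m)) =
        RingTensor.tmul _ x (M.latchingπ i (M.map α (a • m)))
      rw [RingTensor.smul_tmul, ← map_smul, (M.map α).map_smulₛₗ])
    (fun {h k} _ _ γ δ x m => by
      change RingTensor.tmul _ x (M.latchingπ i (M.map (γ ≫ δ) m)) =
        RingTensor.tmul _ (op (R.tau γ δ : R.obj i) • x) (M.latchingπ i (M.map δ (M.map γ m)))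
      rw [RingTensor.smul_tmul, ← map_smul, M.map_comp])
    (fun {h k} hh _ γ δ x m => by
      change RingTensor.mk _ x (M.latchingπ i (M.map δ (M.map γ m))) = 0
      have h0 : M.latchingπ i ((R.tau γ δ : R.obj i) • M.map δ (M.map γ m)) = 0 := by
        rw [← M.map_comp, latchingπ_map _ _ hh]
      rw [map_smul] at h0
      rw [(R.tau γ δ).isUnit.smul_eq_zero.1 h0, map_zero])
  refine ⟨e.toAddEquiv k ?_ ?_, fun hh α x m => he hh α x m⟩
  · refine M.freeTmul_hom_ext hQ fun hh α x m => ?_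
    rw [AddMonoidHom.comp_apply, he hh]
    refine (hk x (M.map α m)).trans ?_
    rw [M.freeUnitTmul_map hQ rfl]
    rfl
  · refine RingTensor.addHom_ext fun x c => ?_
    obtain ⟨p, rfl⟩ := M.latchingπ_surjective i c
    rw [AddMonoidHom.comp_apply, hk]
    refine (he rfl (𝟙 i) (op (((R.eta i)⁻¹ : (R.obj i)ˣ) : R.obj i) • x) p).trans ?_
    change RingTensor.tmul _ (op (((R.eta i)⁻¹ : (R.obj i)ˣ) : R.obj i) • x)
      (M.latchingπ i (M.map (𝟙 i) p)) = RingTensor.tmul _ x (M.latchingπ i p)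
    rw [RingTensor.smul_tmul, ← map_smul, M.map_id, smul_smul, Units.inv_mul, one_smul]

theorem flat_cokernel_of_flat (hI : IsDirectCategory I) (hM : flatObjects R M) (i : I) :
    flatModules (R.obj i) (cokernel (M.latchingMap i)) := by
  intro N N' N'' f g hfg
  choose e he using fun X : ModuleCat.{u} (R.obj i)ᵐᵒᵖ => exists_tensor_stalk_equiv hI M i X
  have hnat {X Y : ModuleCat.{u} (R.obj i)ᵐᵒᵖ} (f : X ⟶ Y) :
      (RingTensor.mapLeft (R.obj i) _ f.hom).comp (e X).toAddMonoidHom =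
        (e Y).toAddMonoidHom.comp (M.tensorMap (stalkMap hI f.hom)) :=
    M.freeTmul_hom_ext _ fun {h} hh α x m => by
      refine (congrArg (RingTensor.mapLeft (R.obj i) _ f.hom) (he X hh α x m)).trans ?_
      refine Eq.trans ?_ (congrArg (e Y)
        (M.tensorMap_freeTmul (Q := (· = i)) _ _ _ f.hom hh α x m)).symm
      rw [he Y hh, RingTensor.mapLeft_tmul]
  exact (hM _ _ _ _ _ (shortExact_stalkMap hI f.hom g.hom hfg)).of_addEquiv (e N) (e N') (e N'')
    (fun x => DFunLike.congr_fun (hnat f) x) (fun x => DFunLike.congr_fun (hnat g) x)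

end LeftRep

end

end

end DiagRep

/-- Over a direct category, the categorically flat representations are exactly those whose latching
maps are monomorphisms with flat cokernels. -/
theorem mainTheorem5 {I : Type u} [SmallCategory I] (hI : DiagRep.IsDirectCategory I)
    (R : DiagRep.RingDiagram I) :
    DiagRep.flatObjects R = DiagRep.Phi R (fun i => DiagRep.flatModules (R.obj i)) := by
  ext M
  exact ⟨fun hM i => ⟨DiagRep.LeftRep.mono_latchingMap_of_flat hI hM i,
    DiagRep.LeftRep.flat_cokernel_of_flat hI hM i⟩, DiagRep.LeftRep.flatObjects_of_phi hI⟩
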